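/- **Theorem 0.1 (Amenable Approximation Theorem).** Let $Y$ be a connected simplicial complex and let $\pi$ be a finitely generated amenable group acting freely and simplicially on $Y$ so that $X=Y/\pi$ is finite (there are finitely many $\pi$-orbits of simplices). Fix a word metric $d_1$ on $\pi$ (invariant under left translations). Let $\mathcal F$ be a finite subcomplex of $Y$ which is a fundamental domain for the action: the translates $g\mathcal F$, $g\in\pi$, cover $Y$, and for $g\ne h$ the topological interiors of $g\mathcal F$ and $h\mathcal F$ in $Y$ are disjoint. Let $\{Y_m\}_{m\ge 1}$ be a regular exhaustion of $Y$, that is, a sequence of finite subcomplexes of $Y$ such that 1. $Y_m$ is the union of $N_m\ge 1$ distinct translates $g\mathcal F$, $g\in\pi$; 2. $Y=\bigcup_{m} Y_m$; 3. for every $\delta>0$, $\lim_{m\to\infty}\dot N_{m,\delta}/N_m=0$, where $\dot N_{m,\delta}$ is the number of $g\in\pi$ for which there is $h\in\pi$ with $d_1(g,h)\le\delta$ and $h\mathcal F\cap\partial Y_m\neq\emptyset$, and $\partial Y_m$ is the topological boundary of $Y_m$ in $Y$. Let $C^j_{(2)}(Y)$ be the Hilbert space of square summable complex simplicial $j$-cochains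 of $Y$ (each simplex being given an orientation), let $d_j:C^j_{(2)}(Y)\to C^{j+1}_{(2)}(Y)$ be the (bounded) coboundary operator, with $d_{-1}=0$, let $\Delta_j=d_{j-1}d_{j-1}^*+d_j^*d_j$, and let $P_j$ be the orthogonal projection of $C^j_{(2)}(Y)$ onto $\ker\Delta_j$. The $j$-th $L^2$ Betti number is the von Neumann trace $$b^j_{(2)}(Y:\pi)=\operatorname{Tr}_\pi(P_j)=\sum_{\sigma}\langle P_j\delta_\sigma,\delta_\sigma\rangle,$$ where $\sigma$ runs over representatives of the $\pi$-orbits of $j$-simplices of $Y$. Then, for every $j\ge 0$, $$\lim_{m\to\infty}\frac{b^j(Y_m)}{N_m}=b^j_{(2)}(Y:\pi)\qquad\text{and}\qquad \lim_{m\to\infty}\frac{b^j(Y_m,\partial Y_m)}{N_m}=b^j_{(2)}(Y:\pi),$$ where $b^j(Y_m)=\dim_{\mathbb C}H^j(Y_m;\mathbb C)$ and $b^j(Y_m,\partial Y_m)=\dim_{\mathbb C}H^j(Y_m,\partial Y_m;\mathbb C)$. -/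

import Mathlib

open Filter Topology
open scoped Pointwise

noncomputable section

namespace AmenableL2

/-! ### Simplicial complexes and subcomplexes

A simplicial complex with vertex set `V` is an `AbstractSimplicialComplex V`; its subcomplexes are
`PreAbstractSimplicialComplex V`s below it (they need not contain every vertex).
A simplex is the finite nonempty set of its vertices. -/

section Complexes

variable {V : Type*}

/-- The `1`-skeleton of a simplicial complex, as a graph. The geometric realization is connected
iff this graph is connected (which includes that it is nonempty). -/
def oneSkeleton [DecidableEq V] (Y : AbstractSimplicialComplex V) : SimpleGraph V where
  Adj u v := u ≠ v ∧ ({u, v} : Finset V) ∈ Y.faces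
  symm := ⟨fun u v h => ⟨h.1.symm, by rw [Finset.pair_comm]; exact h.2⟩⟩
  loopless := ⟨fun _ h => h.1 rfl⟩

/-- The topological interior of (the realization of) the subcomplex `K` inside `Y`: it is the union
of the open simplices `s` of `K` such that all simplices of `Y` having `s` as a face are in `K`. -/
def interiorFaces (Y : AbstractSimplicialComplex V) (K : PreAbstractSimplicialComplex V) :
    Set (Finset V) :=
  {s | s ∈ K.faces ∧ ∀ t ∈ Y.faces, s ⊆ t → t ∈ K.faces}

/-- The topological boundary `∂K` of the subcomplex `K` inside `Y`: the simplices of `K` which do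
not lie in the interior of `K`, i.e. which are faces of some simplex of `Y` outside `K`. -/
def boundary (Y : AbstractSimplicialComplex V) (K : PreAbstractSimplicialComplex V) :
    PreAbstractSimplicialComplex V where
  faces := K.faces \ interiorFaces Y K
  isRelLowerSet_faces := by
    intro s hs
    obtain ⟨hK, hi⟩ := hs
    refine ⟨(K.isRelLowerSet_faces hK).1, fun t hts ht => ?_⟩
    refine ⟨(K.isRelLowerSet_faces hK).2 hts ht, fun hint => hi ⟨hK, fun r hr hsr => ?_⟩⟩
    exact hint.2 r hr (hts.trans hsr)

/-- The `n`-simplices of a complex. -/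
abbrev Simplex (K : PreAbstractSimplicialComplex V) (n : ℕ) : Type _ :=
  {s : Finset V // s ∈ K.faces ∧ s.card = n + 1}

variable [LinearOrder V]

/-- The `i`-th face of an `(n+1)`-simplex, obtained by deleting its `i`-th vertex. (The vertices
are totally ordered; the order serves only to orient the simplices.) -/
def Simplex.face {K : PreAbstractSimplicialComplex V} {n : ℕ} (s : Simplex K (n + 1))
    (i : Fin (n + 2)) : Simplex K n :=
  ⟨s.1.erase (s.1.orderEmbOfFin s.2.2 i), by
    have hc : (s.1.erase (s.1.orderEmbOfFin s.2.2 i)).card = n + 1 := by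
      rw [Finset.card_erase_of_mem (Finset.orderEmbOfFin_mem _ _ _), s.2.2]
      rfl
    exact ⟨(K.isRelLowerSet_faces s.2.1).2 (Finset.erase_subset _ _)
      (Finset.card_pos.mp (by omega)), hc⟩⟩

/-- The simplicial coboundary `d : C^n(K) → C^{n+1}(K)`,
`(d f)[v₀, …, v_{n+1}] = ∑ᵢ (-1)^i f[v₀, …, v̂ᵢ, …, v_{n+1}]` for `v₀ < ⋯ < v_{n+1}`. -/
def coboundary (K : PreAbstractSimplicialComplex V) (n : ℕ) :
    (Simplex K n → ℂ) →ₗ[ℂ] (Simplex K (n + 1) → ℂ) where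
  toFun f s := ∑ i : Fin (n + 2), (-1 : ℂ) ^ (i : ℕ) * f (s.face i)
  map_add' f g := by
    funext s
    simp [mul_add, Finset.sum_add_distrib]
  map_smul' c f := by
    funext s
    simp only [Pi.smul_apply, smul_eq_mul, RingHom.id_apply, Finset.mul_sum]
    exact Finset.sum_congr rfl fun i _ => by ring

/-- The relative cochains `C^n(K, L)`: cochains on `K` that vanish on `L`. -/
def relCochains (K L : PreAbstractSimplicialComplex V) (n : ℕ) : Submodule ℂ (Simplex K n → ℂ) where
  carrier := {f | ∀ s : Simplex K n, s.1 ∈ L.faces → f s = 0}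
  add_mem' hf hg s hs := by simp [hf s hs, hg s hs]
  zero_mem' _ _ := rfl
  smul_mem' c f hf s hs := by simp [hf s hs]

/-- The relative cocycles `Z^n(K, L)`. -/
def relCocycles (K L : PreAbstractSimplicialComplex V) (n : ℕ) : Submodule ℂ (Simplex K n → ℂ) :=
  relCochains K L n ⊓ LinearMap.ker (coboundary K n)

/-- The relative coboundaries `B^n(K, L)`. -/
def relCoboundaries (K L : PreAbstractSimplicialComplex V) :
    (n : ℕ) → Submodule ℂ (Simplex K n → ℂ)
  | 0 => ⊥
  | n + 1 => (relCochains K L n).map (coboundary K n)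

/-- The relative Betti number `b^n(K, L) = dim H^n(K, L; ℂ)`. -/
def relBetti (K L : PreAbstractSimplicialComplex V) (n : ℕ) : ℕ :=
  Module.finrank ℂ (relCocycles K L n ⧸ (relCoboundaries K L n).submoduleOf (relCocycles K L n))

/-- The Betti number `b^n(K) = dim H^n(K; ℂ)`. -/
def betti (K : PreAbstractSimplicialComplex V) (n : ℕ) : ℕ := relBetti K ⊥ n

end Complexes

/-! ### Free simplicial actions with finite quotient -/

section Actions

variable (π : Type*) [Group π] {V : Type*} [LinearOrder V] [MulAction π V]

/-- `π` acts freely and simplicially on `Y`, with finite quotient. The action on the realization is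
free iff no nontrivial element maps a simplex onto itself. -/
class IsFreeCofinite (Y : AbstractSimplicialComplex V) : Prop where
  smul_mem : ∀ (g : π) (s : Finset V), s ∈ Y.faces → g • s ∈ Y.faces
  free : ∀ (g : π) (s : Finset V), s ∈ Y.faces → g • s = s → g = 1
  cofinite : ∃ T : Set (Finset V), T.Finite ∧ ∀ s ∈ Y.faces, ∃ t ∈ T, ∃ g : π, s = g • t

variable {π} in
/-- The translate `g.K` of a subcomplex. -/
def translate (g : π) (K : PreAbstractSimplicialComplex V) : PreAbstractSimplicialComplex V :=
  K.map (fun v => g • v)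

/-- The subcomplex `F` of `Y` is a finite subcomplex which is a fundamental domain for the action of
`π`: its translates cover `Y`, and distinct translates have disjoint interiors. -/
structure IsFundamentalDomain (Y : AbstractSimplicialComplex V)
    (F : PreAbstractSimplicialComplex V) : Prop where
  le : F ≤ Y.toPreAbstractSimplicialComplex
  finite : F.faces.Finite
  covers : ∀ s ∈ Y.faces, ∃ g : π, s ∈ (translate g F).faces
  disjoint : ∀ g h : π, g ≠ h →
    Disjoint (interiorFaces Y (translate g F)) (interiorFaces Y (translate h F))

end Actions

/-! ### Square summable cochains -/

section L2

variable (π : Type*) [Group π] {V : Type*} [LinearOrder V] [MulAction π V]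

/-- The Hilbert space `C^n_{(2)}(Y)` of square summable cochains. -/
abbrev L2Cochains (Y : AbstractSimplicialComplex V) (n : ℕ) : Type _ :=
  lp (fun _ : Simplex Y.toPreAbstractSimplicialComplex n => ℂ) 2

/-- A simplicial complex with a free cofinite action is uniformly locally finite. -/
theorem exists_card_cofaces_le (Y : AbstractSimplicialComplex V) [IsFreeCofinite π Y] :
    ∃ B : ℕ, ∀ s ∈ Y.faces, ∀ A : Finset (Finset V), (∀ t ∈ A, t ∈ Y.faces ∧ s ⊆ t) →
      A.card ≤ B := by
  classical
  obtain ⟨T, hT, hcov⟩ := IsFreeCofinite.cofinite (π := π) (Y := Y)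
  refine ⟨(hT.toFinset.biUnion fun r => r.powerset.image fun u => (r, u)).card,
    fun s hs A hA => ?_⟩
  have h : ∀ t : Finset V, ∃ r : Finset V, ∃ g : π, t ∈ A → r ∈ T ∧ t = g • r := by
    intro t
    by_cases ht : t ∈ A
    · obtain ⟨r, hr, g, hg⟩ := hcov t (hA t ht).1
      exact ⟨r, g, fun _ => ⟨hr, hg⟩⟩
    · exact ⟨∅, 1, fun h => (ht h).elim⟩
  choose r g hrg using h
  refine Finset.card_le_card_of_injOn (fun t => (r t, (g t)⁻¹ • s)) ?_ ?_
  · intro t ht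
    obtain ⟨hr, hg⟩ := hrg t ht
    simp only [Finset.coe_biUnion, Set.mem_iUnion, Finset.mem_coe, Finset.mem_image,
      Finset.mem_powerset, Set.Finite.mem_toFinset]
    refine ⟨r t, hr, (g t)⁻¹ • s, ?_, rfl⟩
    have h2 := (hA t ht).2
    rw [hg] at h2
    exact Finset.smul_finset_subset_iff.mpr (by simpa using h2)
  · intro t ht t' ht' heq
    simp only [Prod.mk.injEq] at heq
    have hgg : g t' = g t := by
      have h1 : (g t * (g t')⁻¹) • s = s := by
        rw [mul_smul, ← heq.2, smul_inv_smul]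
      have h2 := IsFreeCofinite.free (g t * (g t')⁻¹) s hs h1
      exact (mul_inv_eq_one.mp h2).symm
    rw [(hrg t ht).2, (hrg t' ht').2, heq.1, hgg]

variable {π} in
/-- The coboundary is bounded for the `ℓ²`-norm: the estimate on finite sets of simplices. -/
theorem exists_sum_coboundary_le (Y : AbstractSimplicialComplex V) [IsFreeCofinite π Y] (n : ℕ) :
    ∃ C : ℝ, 0 ≤ C ∧ ∀ (f : L2Cochains Y n)
      (T : Finset (Simplex Y.toPreAbstractSimplicialComplex (n + 1))),
      ∑ t ∈ T, ‖coboundary Y.toPreAbstractSimplicialComplex n f t‖ ^ 2 ≤ C * ‖f‖ ^ 2 := by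
  classical
  obtain ⟨B, hB⟩ := exists_card_cofaces_le π Y
  refine ⟨(n + 2) * ((n + 2) * B), by positivity, fun f T => ?_⟩
  have hf : ∀ A : Finset (Simplex Y.toPreAbstractSimplicialComplex n),
      ∑ s ∈ A, ‖f s‖ ^ 2 ≤ ‖f‖ ^ 2 := by
    intro A
    have := lp.sum_rpow_le_norm_rpow (p := 2) (by norm_num) f A
    simpa using this
  have h1 : ∀ i : Fin (n + 2), ∑ t ∈ T, ‖f (t.face i)‖ ^ 2 ≤ B * ‖f‖ ^ 2 := by
    intro i
    have h2 := Finset.sum_fiberwise_of_maps_to (s := T) (t := T.image fun t => t.face i)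
      (g := fun t => t.face i) (fun t ht => Finset.mem_image_of_mem _ ht)
      (fun t => ‖f (t.face i)‖ ^ 2)
    rw [← h2]
    calc _ ≤ ∑ s ∈ T.image fun t => t.face i, (B : ℝ) * ‖f s‖ ^ 2 := by
          refine Finset.sum_le_sum fun s _ => ?_
          have h3 : ∑ t ∈ T with t.face i = s, ‖f (t.face i)‖ ^ 2
              = ((T.filter fun t => t.face i = s).card : ℝ) * ‖f s‖ ^ 2 := by
            rw [← nsmul_eq_mul]
            refine Finset.sum_eq_card_nsmul fun t ht => ?_
            rw [(Finset.mem_filter.mp ht).2]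
          rw [h3]
          have h4 : (T.filter fun t => t.face i = s).card ≤ B := by
            rw [← Finset.card_image_of_injective _ Subtype.val_injective]
            refine hB s.1 s.2.1 _ fun t ht => ?_
            obtain ⟨t', ht', rfl⟩ := Finset.mem_image.mp ht
            refine ⟨t'.2.1, ?_⟩
            rw [← (Finset.mem_filter.mp ht').2]
            exact Finset.erase_subset _ _
          gcongr
      _ ≤ B * ‖f‖ ^ 2 := by
          rw [← Finset.mul_sum]
          gcongr
          exact hf _
  calc ∑ t ∈ T, ‖coboundary Y.toPreAbstractSimplicialComplex n f t‖ ^ 2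
      ≤ ∑ t ∈ T, ((n + 2 : ℝ)) * ∑ i : Fin (n + 2), ‖f (t.face i)‖ ^ 2 := by
        refine Finset.sum_le_sum fun t _ => ?_
        have h5 : ‖coboundary Y.toPreAbstractSimplicialComplex n f t‖
            ≤ ∑ i : Fin (n + 2), ‖f (t.face i)‖ := by
          change ‖∑ i : Fin (n + 2), (-1 : ℂ) ^ (i : ℕ) * f (t.face i)‖ ≤ _
          refine (norm_sum_le _ _).trans (Finset.sum_le_sum fun i _ => ?_)
          simp
        have h6 := sq_sum_le_card_mul_sum_sq (s := (Finset.univ : Finset (Fin (n + 2))))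
          (f := fun i => ‖f (t.face i)‖)
        have h7 : ‖coboundary Y.toPreAbstractSimplicialComplex n f t‖ ^ 2
            ≤ (∑ i : Fin (n + 2), ‖f (t.face i)‖) ^ 2 := by gcongr
        refine h7.trans (h6.trans ?_)
        simp
    _ = (n + 2 : ℝ) * ∑ i : Fin (n + 2), ∑ t ∈ T, ‖f (t.face i)‖ ^ 2 := by
        rw [← Finset.mul_sum, Finset.sum_comm]
    _ ≤ (n + 2 : ℝ) * ∑ _i : Fin (n + 2), B * ‖f‖ ^ 2 := by
        gcongr with i
        exact h1 i
    _ = (n + 2) * ((n + 2) * B) * ‖f‖ ^ 2 := by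
        simp
        ring

/-- The coboundary as an operator on square summable cochains, `C^n_{(2)}(Y) → C^{n+1}_{(2)}(Y)`;
it is bounded. -/
def l2Coboundary (Y : AbstractSimplicialComplex V) [IsFreeCofinite π Y] (n : ℕ) :
    L2Cochains Y n →L[ℂ] L2Cochains Y (n + 1) :=
  LinearMap.mkContinuousOfExistsBound
    { toFun := fun f => ⟨coboundary Y.toPreAbstractSimplicialComplex n f, by
        obtain ⟨C, -, hC⟩ := exists_sum_coboundary_le (π := π) Y n
        refine memℓp_gen' (C := C * ‖f‖ ^ 2) fun T => ?_
        simpa using hC f T⟩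
      map_add' := fun f g => by
        ext1
        exact map_add (coboundary Y.toPreAbstractSimplicialComplex n) (⇑f) (⇑g)
      map_smul' := fun c f => by
        ext1
        exact map_smul (coboundary Y.toPreAbstractSimplicialComplex n) c (⇑f) }
    (by
      obtain ⟨C, hC0, hC⟩ := exists_sum_coboundary_le (π := π) Y n
      refine ⟨√C, fun f => ?_⟩
      refine lp.norm_le_of_forall_sum_le (by norm_num) (by positivity) fun T => ?_
      have := hC f T
      simpa [mul_pow, Real.sq_sqrt hC0] using this)

/-- The combinatorial Laplacian `Δ_n = d_{n-1} d_{n-1}^* + d_n^* d_n` on `C^n_{(2)}(Y)`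
(with `d_{-1} = 0`). -/
def l2Laplacian (Y : AbstractSimplicialComplex V) [IsFreeCofinite π Y] :
    (n : ℕ) → (L2Cochains Y n →L[ℂ] L2Cochains Y n)
  | 0 => (l2Coboundary π Y 0).adjoint ∘L l2Coboundary π Y 0
  | n + 1 => l2Coboundary π Y n ∘L (l2Coboundary π Y n).adjoint +
      (l2Coboundary π Y (n + 1)).adjoint ∘L l2Coboundary π Y (n + 1)

/-- The orthogonal projection `P_n` of `C^n_{(2)}(Y)` onto the kernel of the Laplacian. -/
def harmonicProjection (Y : AbstractSimplicialComplex V) [IsFreeCofinite π Y] (n : ℕ) :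
    L2Cochains Y n →L[ℂ] L2Cochains Y n :=
  (LinearMap.ker (l2Laplacian π Y n).toLinearMap).starProjection

/-- Two `n`-simplices of `Y` are equivalent if they lie in the same `π`-orbit, that is, if they lie
over the same simplex of `Y / π`. -/
def orbitSetoid (Y : AbstractSimplicialComplex V) (n : ℕ) :
    Setoid (Simplex Y.toPreAbstractSimplicialComplex n) :=
  (MulAction.orbitRel π (Finset V)).comap Subtype.val

/-- The von Neumann trace of an operator `A` on `C^n_{(2)}(Y)` commuting with `π`:
the sum of `⟨A δ_σ, δ_σ⟩`, one (arbitrary) `n`-simplex `σ` being chosen from each orbit.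
The sum is finite. -/
def vonNeumannTrace (Y : AbstractSimplicialComplex V) (n : ℕ)
    (A : L2Cochains Y n →L[ℂ] L2Cochains Y n) : ℂ :=
  ∑ᶠ x : Quotient (orbitSetoid π Y n), inner ℂ (lp.single 2 x.out 1) (A (lp.single 2 x.out 1))

/-- The `n`-th `L²` Betti number `b_{(2)}^n(Y : π)`, the von Neumann trace of `P_n`
(which is a real number). -/
def l2Betti (Y : AbstractSimplicialComplex V) [IsFreeCofinite π Y] (n : ℕ) : ℝ :=
  (vonNeumannTrace π Y n (harmonicProjection π Y n)).re

end L2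

/-! ### Word metric, amenability, regular exhaustions -/

section Amenable

variable {π : Type*} [Group π]

/-- The word metric on a group with (finite) generating set `S`: the least length of a word in the
elements of `S` and their inverses that represents `g⁻¹ * h`. It is invariant under left
translations. -/
def wordDist (S : Finset π) (g h : π) : ℕ :=
  sInf {n | ∃ l : List π, l.length = n ∧ (∀ x ∈ l, x ∈ S ∨ x⁻¹ ∈ S) ∧ l.prod = g⁻¹ * h}

/-- The `δ`-neighbourhood of the boundary of a subset of the group. -/
def groupBoundary (S : Finset π) (δ : ℝ) (A : Finset π) : Set π :=
  {γ | (∃ a ∈ A, (wordDist S γ a : ℝ) < δ) ∧ ∃ b ∉ A, (wordDist S γ b : ℝ) < δ}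

/-- Amenability of the group generated by `S`, by Følner's criterion. -/
def IsAmenable (S : Finset π) : Prop :=
  ∃ A : ℕ → Finset π, (∀ k, (A k).Nonempty) ∧
    ∀ δ : ℝ, 0 < δ →
      Tendsto (fun k => ((groupBoundary S δ (A k)).ncard : ℝ) / (A k).card) atTop (𝓝 0)

variable {V : Type*} [LinearOrder V] [MulAction π V]

/-- The set of (indices `g` of) translates `g.F` which have distance at most `δ` from a translate of
`F` having nonempty intersection with the topological boundary of `K`. -/
def nearBoundary (S : Finset π) (Y : AbstractSimplicialComplex V)
    (F K : PreAbstractSimplicialComplex V) (δ : ℝ) : Set π :=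
  {g | ∃ h : π, ((translate h F).faces ∩ (boundary Y K).faces).Nonempty ∧
    (wordDist S g h : ℝ) ≤ δ}

/-- A regular exhaustion `Y_0, Y_1, …` of `Y`, relative to the fundamental domain `F`: the complex
`Y_m` consists of the `N_m = #(Λ m) > 0` translates `g.F`, `g ∈ Λ m`. -/
structure IsRegularExhaustion (S : Finset π) (Y : AbstractSimplicialComplex V)
    (F : PreAbstractSimplicialComplex V) (Λ : ℕ → Finset π)
    (Ym : ℕ → PreAbstractSimplicialComplex V) : Prop where
  nonempty : ∀ m, (Λ m).Nonempty
  eq_iSup : ∀ m, Ym m = ⨆ g ∈ Λ m, translate g F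
  exhausts : ⨆ m, Ym m = Y.toPreAbstractSimplicialComplex
  tendsto_zero : ∀ δ : ℝ, 0 < δ →
    Tendsto (fun m => ((nearBoundary S Y F (Ym m) δ).ncard : ℝ) / (Λ m).card) atTop (𝓝 0)

end Amenable

end AmenableL2

end

open AmenableL2

/-! Fix a finite union `K` of translates `g • F`, `g ∈ Λ`, and let `P` be the harmonic projection.
The point is that both `betti K n` and `#Λ * l2Betti` are close to the local trace `∑ ‖P δ_a‖²` over
the `n`-simplices `a` of `K`, with errors proportional to the number of translates meeting `∂K`;
dividing by `#Λ` finishes. No spectral convergence is needed.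

The Betti number is compared by building subspaces of `ℓ²` supported on `K`: such a subspace inside
`U` has dimension at most `∑ ‖P_U δ_a‖²` (`finrank_le_sum_norm_sq_starProjection`). For `U` the
harmonic space, take relative cocycles of `(K, ∂K)` orthogonal to the absolute coboundaries of `K`
(`betti_le_sum_norm_sq_harmonicProjection`). For its orthogonal complement, take relative
coboundaries together with `d*` of the coboundaries in degree `n + 1`
(`sum_norm_sq_harmonicProjection_le`). Passing between absolute and relative cochains costs at most
the number of simplices of `∂K`, so the local trace is squeezed from both sides.

On the other side, `‖P δ_a‖` depends only on the orbit of `a`, and each orbit meets `K` in `#Λ`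
simplices up to the boundary error (`abs_sum_sub_le`). Relative Betti numbers differ from absolute
ones by at most the size of `∂K` (`abs_relBetti_sub_betti_le`). -/

noncomputable section

namespace AmenableL2

/-! ### The coboundary as a sum over vertices -/

section Coboundary

variable {V : Type*}

/-- A cochain as a function on all finite sets of vertices, zero away from the simplices. -/
def extendZero {K : PreAbstractSimplicialComplex V} {n : ℕ} (f : Simplex K n → ℂ)
    (s : Finset V) : ℂ :=
  open Classical in if h : s ∈ K.faces ∧ s.card = n + 1 then f ⟨s, h⟩ else 0

theorem extendZero_of_mem {K : PreAbstractSimplicialComplex V} {n : ℕ} (f : Simplex K n → ℂ)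
    {s : Finset V} (h : s ∈ K.faces ∧ s.card = n + 1) : extendZero f s = f ⟨s, h⟩ :=
  dif_pos h

theorem extendZero_of_notMem {K : PreAbstractSimplicialComplex V} {n : ℕ} (f : Simplex K n → ℂ)
    {s : Finset V} (h : s ∉ K.faces) : extendZero f s = 0 :=
  dif_neg fun h' => h h'.1

theorem extendZero_coe {K : PreAbstractSimplicialComplex V} {n : ℕ} (f : Simplex K n → ℂ)
    (s : Simplex K n) : extendZero f s.1 = f s :=
  extendZero_of_mem f s.2

/-- Restriction of cochains to a subcomplex. -/
def restrict {K L : PreAbstractSimplicialComplex V} (h : K ≤ L) (n : ℕ) :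
    (Simplex L n → ℂ) →ₗ[ℂ] (Simplex K n → ℂ) :=
  LinearMap.funLeft ℂ ℂ fun s => ⟨s.1, h s.2.1, s.2.2⟩

theorem restrict_apply {K L : PreAbstractSimplicialComplex V} (h : K ≤ L) (n : ℕ)
    (f : Simplex L n → ℂ) (s : Simplex K n) : restrict h n f s = f ⟨s.1, h s.2.1, s.2.2⟩ := rfl

theorem finite_simplex {K : PreAbstractSimplicialComplex V} (hfin : K.faces.Finite) (n : ℕ) :
    Finite (Simplex K n) :=
  (hfin.subset fun _ h => h.1 : {s | s ∈ K.faces ∧ s.card = n + 1}.Finite).to_subtype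

variable [LinearOrder V]

/-- The incidence sign of the face of `s` opposite to the vertex `v`. -/
def vertexSign (s : Finset V) (v : V) : ℂ := (-1) ^ (s.filter (· < v)).card

theorem Simplex.erase_mem {K : PreAbstractSimplicialComplex V} {n : ℕ} (s : Simplex K (n + 1))
    {v : V} (hv : v ∈ s.1) : s.1.erase v ∈ K.faces ∧ (s.1.erase v).card = n + 1 := by
  have hc : (s.1.erase v).card = n + 1 := by
    rw [Finset.card_erase_of_mem hv, s.2.2]
    rfl
  exact ⟨(K.isRelLowerSet_faces s.2.1).2 (Finset.erase_subset _ _)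
    (Finset.card_pos.mp (by omega)), hc⟩

theorem vertexSign_orderEmbOfFin (s : Finset V) {k : ℕ} (h : s.card = k) (i : Fin k) :
    vertexSign s (s.orderEmbOfFin h i) = (-1 : ℂ) ^ (i : ℕ) := by
  have h1 : s.filter (· < s.orderEmbOfFin h i)
      = (Finset.Iio i).map (s.orderEmbOfFin h).toEmbedding := by
    ext a
    simp only [Finset.mem_filter, Finset.mem_map, Finset.mem_Iio, RelEmbedding.coe_toEmbedding]
    constructor
    · rintro ⟨ha, hlt⟩
      rw [← Finset.mem_coe, ← Finset.range_orderEmbOfFin s h] at ha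
      obtain ⟨k, rfl⟩ := ha
      exact ⟨k, (OrderEmbedding.lt_iff_lt _).mp hlt, rfl⟩
    · rintro ⟨k, hk, rfl⟩
      exact ⟨Finset.orderEmbOfFin_mem _ _ _, (OrderEmbedding.lt_iff_lt _).mpr hk⟩
  rw [vertexSign, h1, Finset.card_map, Fin.card_Iio]

/-- Indexing by vertices rather than positions makes iterated deletion and the action of a group
element plain manipulations of finite sets. -/
theorem coboundary_apply (K : PreAbstractSimplicialComplex V) (n : ℕ) (f : Simplex K n → ℂ)
    (s : Simplex K (n + 1)) :
    coboundary K n f s = ∑ v ∈ s.1, vertexSign s.1 v * extendZero f (s.1.erase v) := by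
  change ∑ i : Fin (n + 2), (-1 : ℂ) ^ (i : ℕ) * f (s.face i) = _
  refine Finset.sum_nbij (s.1.orderEmbOfFin s.2.2) (fun i _ => Finset.orderEmbOfFin_mem _ _ _)
    (fun i _ k _ h => (s.1.orderEmbOfFin s.2.2).injective h) ?_ fun i _ => ?_
  · intro v hv
    rw [← Finset.range_orderEmbOfFin s.1 s.2.2] at hv
    simpa using hv
  · rw [vertexSign_orderEmbOfFin, ← extendZero_coe f (s.face i)]
    rfl

/-- For `v < w`, deleting `w` does not change the number of vertices below `v`, while deleting `v`
lowers the number below `w` by one. -/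
theorem vertexSign_mul_vertexSign_erase {s : Finset V} {v w : V} (hv : v ∈ s) (hw : w ∈ s)
    (hvw : v ≠ w) :
    vertexSign s v * vertexSign (s.erase v) w = -(vertexSign s w * vertexSign (s.erase w) v) := by
  wlog h : v < w generalizing v w
  · rw [this hw hv hvw.symm (lt_of_le_of_ne (not_lt.mp h) hvw.symm), neg_neg]
  have h1 : (s.erase w).filter (· < v) = s.filter (· < v) := by
    ext a
    simp only [Finset.mem_filter, Finset.mem_erase]
    exact ⟨fun h' => ⟨h'.1.2, h'.2⟩, fun h' => ⟨⟨(h'.2.trans h).ne, h'.1⟩, h'.2⟩⟩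
  have h2 : s.filter (· < w) = insert v ((s.erase v).filter (· < w)) := by
    ext a
    simp only [Finset.mem_filter, Finset.mem_erase, Finset.mem_insert]
    constructor
    · intro h'
      by_cases ha : a = v
      · exact Or.inl ha
      · exact Or.inr ⟨⟨ha, h'.1⟩, h'.2⟩
    · rintro (rfl | h')
      · exact ⟨hv, h⟩
      · exact ⟨h'.1.2, h'.2⟩
  unfold vertexSign
  rw [h1, h2, Finset.card_insert_of_notMem (by simp), pow_succ]
  ring

theorem coboundary_comp_coboundary (K : PreAbstractSimplicialComplex V) (n : ℕ)
    (f : Simplex K n → ℂ) : coboundary K (n + 1) (coboundary K n f) = 0 := by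
  funext s
  set F : V → V → ℂ := fun v w =>
    vertexSign s.1 v * vertexSign (s.1.erase v) w * extendZero f ((s.1.erase v).erase w)
  have h1 : coboundary K (n + 1) (coboundary K n f) s
      = ∑ v ∈ s.1, ∑ w ∈ s.1.erase v, F v w := by
    rw [coboundary_apply]
    refine Finset.sum_congr rfl fun v hv => ?_
    rw [extendZero_of_mem _ (s.erase_mem hv), coboundary_apply, Finset.mul_sum]
    exact Finset.sum_congr rfl fun w _ => (mul_assoc _ _ _).symm
  -- Exchanging the two deleted vertices flips the sign of each term, so the sum is its own
  -- negative.
  have h2 : ∑ v ∈ s.1, ∑ w ∈ s.1.erase v, F v w = -∑ v ∈ s.1, ∑ w ∈ s.1.erase v, F v w := by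
    conv_lhs => rw [Finset.sum_comm' (t' := s.1) (s' := fun w => s.1.erase w) (by
      intro x y
      simp only [Finset.mem_erase]
      tauto)]
    rw [← Finset.sum_neg_distrib]
    refine Finset.sum_congr rfl fun v hv => ?_
    rw [← Finset.sum_neg_distrib]
    refine Finset.sum_congr rfl fun w hw => ?_
    rw [Finset.mem_erase] at hw
    simp only [F]
    rw [vertexSign_mul_vertexSign_erase hw.2 hv hw.1, Finset.erase_right_comm, neg_mul]
  rw [h1, Pi.zero_apply]
  exact self_eq_neg.mp h2

theorem coboundary_restrict {K L : PreAbstractSimplicialComplex V} (h : K ≤ L) (n : ℕ)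
    (f : Simplex L n → ℂ) :
    coboundary K n (restrict h n f) = restrict h (n + 1) (coboundary L n f) := rfl

end Coboundary

/-! ### Extension by zero of cochains of a finite subcomplex -/

section ExtendL2

variable {V : Type*} {Y : AbstractSimplicialComplex V}
  {K : PreAbstractSimplicialComplex V}

/-- Extension by zero, `C^n(K) → C^n_{(2)}(Y)`. -/
def extendL2 (Y : AbstractSimplicialComplex V) (hfin : K.faces.Finite) (n : ℕ) :
    (Simplex K n → ℂ) →ₗ[ℂ] L2Cochains Y n where
  toFun f := ⟨fun t => extendZero f t.1, by
    refine Memℓp.of_exponent_ge (q := 0) (memℓp_zero ?_) zero_le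
    refine Set.Finite.preimage Subtype.val_injective.injOn (hfin.subset fun s hs => ?_) |>.subset
      (t := Subtype.val ⁻¹' {s | extendZero f s ≠ 0}) fun _ h => h
    by_contra h
    exact hs (extendZero_of_notMem f h)⟩
  map_add' f g := by
    ext t
    change extendZero (f + g) t.1 = extendZero f t.1 + extendZero g t.1
    unfold extendZero
    split_ifs <;> simp
  map_smul' c f := by
    ext t
    change extendZero (c • f) t.1 = c • extendZero f t.1
    unfold extendZero
    split_ifs <;> simp

theorem extendL2_apply (hfin : K.faces.Finite) (n : ℕ) (f : Simplex K n → ℂ)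
    (t : Simplex Y.toPreAbstractSimplicialComplex n) :
    extendL2 Y hfin n f t = extendZero f t.1 := rfl

theorem restrict_extendL2 (hK : K ≤ Y.toPreAbstractSimplicialComplex) (hfin : K.faces.Finite)
    (n : ℕ) (f : Simplex K n → ℂ) : restrict hK n (extendL2 Y hfin n f) = f := by
  funext s
  exact extendZero_coe f s

theorem extendL2_injective (hK : K ≤ Y.toPreAbstractSimplicialComplex) (hfin : K.faces.Finite)
    (n : ℕ) : Function.Injective (extendL2 Y hfin n) := by
  intro f g h
  rw [← restrict_extendL2 hK hfin n f, h, restrict_extendL2 hK hfin n g]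

/-- Restriction is adjoint to extension by zero; both pairings are kept in `ℓ²`, so that cochains of
`K` need no inner product of their own. -/
theorem inner_extendL2 (hK : K ≤ Y.toPreAbstractSimplicialComplex) (hfin : K.faces.Finite)
    (n : ℕ) (x : L2Cochains Y n) (f : Simplex K n → ℂ) :
    inner ℂ x (extendL2 Y hfin n f)
      = inner ℂ (extendL2 Y hfin n (restrict hK n x)) (extendL2 Y hfin n f) := by
  rw [lp.inner_eq_tsum, lp.inner_eq_tsum]
  refine tsum_congr fun t => ?_
  simp only [extendL2_apply]
  by_cases ht : t.1 ∈ K.faces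
  · rw [extendZero_of_mem (restrict hK n x) ⟨ht, t.2.2⟩]
    rfl
  · rw [extendZero_of_notMem f ht, inner_zero_right, inner_zero_right]

variable [LinearOrder V] (π : Type*) [Group π] [MulAction π V] [IsFreeCofinite π Y]

theorem l2Coboundary_apply (n : ℕ) (x : L2Cochains Y n) :
    ⇑(l2Coboundary π Y n x) = coboundary Y.toPreAbstractSimplicialComplex n x := rfl

theorem l2Coboundary_comp_l2Coboundary (n : ℕ) (x : L2Cochains Y n) :
    l2Coboundary π Y (n + 1) (l2Coboundary π Y n x) = 0 := by
  ext1
  exact coboundary_comp_coboundary _ _ _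

/-- A simplex outside `K` can only see `f` through its faces in `K`, and those lie in the boundary,
where `f` vanishes. -/
theorem l2Coboundary_extendL2 (hK : K ≤ Y.toPreAbstractSimplicialComplex) (hfin : K.faces.Finite)
    (n : ℕ) {f : Simplex K n → ℂ} (hf : f ∈ relCochains K (boundary Y K) n) :
    l2Coboundary π Y n (extendL2 Y hfin n f) = extendL2 Y hfin (n + 1) (coboundary K n f) := by
  ext t
  rw [l2Coboundary_apply, extendL2_apply]
  by_cases ht : t.1 ∈ K.faces
  · rw [extendZero_of_mem _ ⟨ht, t.2.2⟩]
    conv_rhs => rw [← restrict_extendL2 hK hfin n f, coboundary_restrict]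
    rfl
  · rw [extendZero_of_notMem _ ht, coboundary_apply]
    refine Finset.sum_eq_zero fun v hv => ?_
    rw [extendZero_of_mem _ (t.erase_mem hv), extendL2_apply]
    by_cases hs : t.1.erase v ∈ K.faces
    · rw [extendZero_of_mem f ⟨hs, (t.erase_mem hv).2⟩, hf, mul_zero]
      exact ⟨hs, fun hint => ht (hint.2 _ t.2.1 (Finset.erase_subset _ _))⟩
    · rw [extendZero_of_notMem _ hs, mul_zero]

end ExtendL2

/-! ### Dimensions of subspaces and traces of projections -/

section Hilbert

/-- The dimension of a space of finitely supported vectors is at most the trace, over the support,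
of the projection onto any closed subspace containing it. -/
theorem finrank_le_sum_norm_sq_starProjection {ι : Type*} [DecidableEq ι]
    (U W : Submodule ℂ (lp (fun _ : ι => ℂ) 2)) [U.HasOrthogonalProjection]
    [FiniteDimensional ℂ W] (hWU : W ≤ U) (A : Finset ι)
    (hA : ∀ w ∈ W, ∀ i ∉ A, (w : ι → ℂ) i = 0) :
    (Module.finrank ℂ W : ℝ) ≤ ∑ a ∈ A, ‖U.starProjection (lp.single 2 a 1)‖ ^ 2 := by
  set b := stdOrthonormalBasis ℂ W
  have hb : Orthonormal ℂ fun i => (b i : lp (fun _ : ι => ℂ) 2) :=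
    b.orthonormal.comp_linearIsometry W.subtypeₗᵢ
  have h1 : ∀ i, ∑ a ∈ A, ‖(b i : lp (fun _ : ι => ℂ) 2) a‖ ^ 2 = 1 := by
    intro i
    have h2 := lp.norm_rpow_eq_tsum (p := 2) (by norm_num) (b i : lp (fun _ : ι => ℂ) 2)
    rw [hb.1 i, tsum_eq_sum (s := A)] at h2
    · simpa using h2.symm
    · intro a ha
      simp [hA _ (b i).2 a ha]
  -- As `b i` lies in `U`, its coordinate at `a` is its pairing with the projected basis vector.
  -- Summing over `i` first then allows Bessel's inequality for each `a`.
  have h3 : ∀ i a, ‖(b i : lp (fun _ : ι => ℂ) 2) a‖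
      = ‖inner ℂ (b i : lp (fun _ : ι => ℂ) 2) (U.starProjection (lp.single 2 a (1 : ℂ)))‖ := by
    intro i a
    rw [← Submodule.inner_starProjection_left_eq_right,
      Submodule.starProjection_eq_self_iff.mpr (hWU (b i).2), lp.inner_single_right]
    simp
  calc (Module.finrank ℂ W : ℝ) = ∑ i, ∑ a ∈ A, ‖(b i : lp (fun _ : ι => ℂ) 2) a‖ ^ 2 := by
        simp [h1]
    _ = ∑ a ∈ A, ∑ i, ‖inner ℂ (b i : lp (fun _ : ι => ℂ) 2)
          (U.starProjection (lp.single 2 a (1 : ℂ)))‖ ^ 2 := by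
        rw [Finset.sum_comm]
        simp only [h3]
    _ ≤ _ := Finset.sum_le_sum fun a _ => hb.sum_inner_products_le _

variable {E : Type*} [NormedAddCommGroup E] [InnerProductSpace ℂ E]

theorem finrank_le_finrank_inf_orthogonal_add (U T : Submodule ℂ E) [FiniteDimensional ℂ U]
    [FiniteDimensional ℂ T] :
    Module.finrank ℂ U ≤ Module.finrank ℂ (U ⊓ Tᗮ : Submodule ℂ E) + Module.finrank ℂ T := by
  set φ : U →ₗ[ℂ] T := T.orthogonalProjectionOnto.toLinearMap ∘ₗ U.subtype
  have h1 := LinearMap.finrank_range_add_finrank_ker φ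
  have h2 : Module.finrank ℂ (LinearMap.range φ) ≤ Module.finrank ℂ T :=
    Submodule.finrank_le _
  have h3 : (LinearMap.ker φ).map U.subtype ≤ U ⊓ Tᗮ := by
    rintro _ ⟨u, hu, rfl⟩
    refine ⟨u.2, ?_⟩
    exact Submodule.orthogonalProjectionOnto_eq_zero_iff.mp hu
  have h4 := Submodule.finrank_mono h3
  rw [(Submodule.equivMapOfInjective _ U.injective_subtype _).finrank_eq.symm] at h4
  omega

theorem finrank_sup_of_isOrtho {W₁ W₂ : Submodule ℂ E} (h : W₁ ⟂ W₂)
    [FiniteDimensional ℂ W₁] [FiniteDimensional ℂ W₂] :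
    Module.finrank ℂ (W₁ ⊔ W₂ : Submodule ℂ E) = Module.finrank ℂ W₁ + Module.finrank ℂ W₂ := by
  rw [← Submodule.finrank_sup_add_finrank_inf_eq, h.disjoint.eq_bot, finrank_bot, add_zero]

end Hilbert

/-! ### Dimension counts for relative cochains -/

section Dimensions

variable {V : Type*} {K L : PreAbstractSimplicialComplex V}

theorem relCochains_bot (K : PreAbstractSimplicialComplex V) (n : ℕ) : relCochains K ⊥ n = ⊤ :=
  eq_top_iff.mpr fun _ _ _ hs => hs.elim

/-- Rank-nullity for evaluation on the simplices of `L`: vanishing there imposes at most one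
condition per simplex. -/
theorem finrank_le_finrank_inf_relCochains_add (hK : K.faces.Finite) (hL : L.faces.Finite) {n : ℕ}
    (U : Submodule ℂ (Simplex K n → ℂ)) :
    Module.finrank ℂ U
      ≤ Module.finrank ℂ (U ⊓ relCochains K L n : Submodule ℂ _) + L.faces.ncard := by
  have := finite_simplex hK n
  set T : Set (Simplex K n) := {s | s.1 ∈ L.faces}
  set φ : U →ₗ[ℂ] (T → ℂ) := LinearMap.funLeft ℂ ℂ (Subtype.val : T → _) ∘ₗ U.subtype
  have h1 := LinearMap.finrank_range_add_finrank_ker φ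
  have h2 : Module.finrank ℂ (LinearMap.range φ) ≤ L.faces.ncard := by
    have := Fintype.ofFinite T
    refine (Submodule.finrank_le _).trans ?_
    rw [Module.finrank_fintype_fun_eq_card, ← Nat.card_eq_fintype_card, Nat.card_coe_set_eq]
    exact Set.ncard_le_ncard_of_injOn Subtype.val (fun s hs => hs) Subtype.val_injective.injOn hL
  have h3 : (LinearMap.ker φ).map U.subtype ≤ U ⊓ relCochains K L n := by
    rintro _ ⟨u, hu, rfl⟩
    exact ⟨u.2, fun s hs => congrFun hu ⟨s, hs⟩⟩
  have h4 := Submodule.finrank_mono h3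
  rw [(Submodule.equivMapOfInjective _ U.injective_subtype _).finrank_eq.symm] at h4
  omega

variable [LinearOrder V]

theorem coboundary_mem_relCochains {n : ℕ} {f : Simplex K n → ℂ} (hf : f ∈ relCochains K L n) :
    coboundary K n f ∈ relCochains K L (n + 1) := by
  intro s hs
  rw [coboundary_apply]
  refine Finset.sum_eq_zero fun v hv => ?_
  rw [extendZero_of_mem _ (s.erase_mem hv), hf, mul_zero]
  exact (L.isRelLowerSet_faces hs).2 (Finset.erase_subset _ _)
    (K.isRelLowerSet_faces (s.erase_mem hv).1).1

theorem relCoboundaries_le_relCocycles (K L : PreAbstractSimplicialComplex V) (n : ℕ) :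
    relCoboundaries K L n ≤ relCocycles K L n := by
  cases n with
  | zero => exact bot_le
  | succ n =>
    rintro _ ⟨f, hf, rfl⟩
    exact ⟨coboundary_mem_relCochains hf, coboundary_comp_coboundary K n f⟩

theorem relCocycles_bot (K : PreAbstractSimplicialComplex V) (n : ℕ) :
    relCocycles K ⊥ n = LinearMap.ker (coboundary K n) := by
  rw [relCocycles, relCochains_bot, top_inf_eq]

theorem relCoboundaries_le_relCoboundaries_bot (K L : PreAbstractSimplicialComplex V) (n : ℕ) :
    relCoboundaries K L n ≤ relCoboundaries K ⊥ n := by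
  cases n with
  | zero => exact bot_le
  | succ n => exact Submodule.map_mono (by rw [relCochains_bot]; exact le_top)

theorem relBetti_add_finrank_relCoboundaries (hK : K.faces.Finite) (n : ℕ) :
    relBetti K L n + Module.finrank ℂ (relCoboundaries K L n)
      = Module.finrank ℂ (relCocycles K L n) := by
  have := finite_simplex hK n
  rw [← Submodule.finrank_quotient_add_finrank
    ((relCoboundaries K L n).submoduleOf (relCocycles K L n)),
    (Submodule.submoduleOfEquivOfLe (relCoboundaries_le_relCocycles K L n)).finrank_eq]
  rfl

theorem finrank_relCocycles_bot_le (hK : K.faces.Finite) (hL : L.faces.Finite) (n : ℕ) :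
    Module.finrank ℂ (relCocycles K ⊥ n)
      ≤ Module.finrank ℂ (relCocycles K L n) + L.faces.ncard := by
  refine (finrank_le_finrank_inf_relCochains_add hK hL _).trans_eq ?_
  rw [relCocycles_bot, inf_comm]
  rfl

theorem finrank_relCocycles_le (hK : K.faces.Finite) (n : ℕ) :
    Module.finrank ℂ (relCocycles K L n) ≤ Module.finrank ℂ (relCocycles K ⊥ n) := by
  have := finite_simplex hK n
  refine Submodule.finrank_mono ?_
  rw [relCocycles_bot]
  exact inf_le_right

theorem finrank_relCoboundaries_bot_le (hK : K.faces.Finite) (hL : L.faces.Finite) (n : ℕ) :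
    Module.finrank ℂ (relCoboundaries K ⊥ n)
      ≤ Module.finrank ℂ (relCoboundaries K L n) + L.faces.ncard := by
  cases n with
  | zero =>
    change Module.finrank ℂ (⊥ : Submodule ℂ (Simplex K 0 → ℂ)) ≤ _
    simp
  | succ n =>
    have := finite_simplex hK n
    have := finite_simplex hK (n + 1)
    change Module.finrank ℂ ((relCochains K ⊥ n).map (coboundary K n))
      ≤ Module.finrank ℂ ((relCochains K L n).map (coboundary K n)) + _
    -- The rank drops by at most the codimension of the relative cochains, since restricting the
    -- domain does not enlarge the kernel.
    have h1 := LinearMap.finrank_range_add_finrank_ker (coboundary K n)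
    have h2 := LinearMap.finrank_range_add_finrank_ker
      ((coboundary K n).domRestrict (relCochains K L n))
    have h3 : Module.finrank ℂ (LinearMap.ker ((coboundary K n).domRestrict (relCochains K L n)))
        ≤ Module.finrank ℂ (LinearMap.ker (coboundary K n)) := by
      rw [(Submodule.equivMapOfInjective _ (relCochains K L n).injective_subtype _).finrank_eq]
      refine Submodule.finrank_mono ?_
      rintro _ ⟨u, hu, rfl⟩
      exact hu
    have h4 := finrank_le_finrank_inf_relCochains_add hK hL (⊤ : Submodule ℂ (Simplex K n → ℂ))
    rw [top_inf_eq, finrank_top] at h4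
    rw [LinearMap.range_domRestrict] at h2
    rw [relCochains_bot, Submodule.map_top]
    omega

theorem finrank_relCoboundaries_le (hK : K.faces.Finite) (n : ℕ) :
    Module.finrank ℂ (relCoboundaries K L n) ≤ Module.finrank ℂ (relCoboundaries K ⊥ n) := by
  have := finite_simplex hK n
  exact Submodule.finrank_mono (relCoboundaries_le_relCoboundaries_bot K L n)

/-- The relative and absolute Betti numbers differ by at most the number of simplices of the
smaller complex. -/
theorem abs_relBetti_sub_betti_le (hK : K.faces.Finite) (hL : L.faces.Finite) (n : ℕ) :
    |(relBetti K L n : ℝ) - betti K n| ≤ L.faces.ncard := by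
  have h1 := relBetti_add_finrank_relCoboundaries (L := L) hK n
  have h2 : betti K n + _ = _ := relBetti_add_finrank_relCoboundaries (L := ⊥) hK n
  have h3 := finrank_relCocycles_bot_le hK hL n
  have h4 := finrank_relCocycles_le (L := L) hK n
  have h5 := finrank_relCoboundaries_bot_le hK hL n
  have h6 := finrank_relCoboundaries_le (L := L) hK n
  -- Cocycles and coboundaries each lose between `0` and `#L` dimensions, so their difference moves
  -- by at most `#L`, not `2 * #L`.
  rw [abs_le]
  constructor
  · have : betti K n ≤ relBetti K L n + L.faces.ncard := by omega
    have : (betti K n : ℝ) ≤ relBetti K L n + L.faces.ncard := by exact_mod_cast this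
    linarith
  · have : relBetti K L n ≤ betti K n + L.faces.ncard := by omega
    have : (relBetti K L n : ℝ) ≤ betti K n + L.faces.ncard := by exact_mod_cast this
    linarith

end Dimensions

/-! ### Harmonic cochains and finite subcomplexes -/

section Harmonic

variable (π : Type*) [Group π] {V : Type*} [LinearOrder V] [MulAction π V]
  (Y : AbstractSimplicialComplex V) [IsFreeCofinite π Y]

/-- The image of the coboundary `C^{n-1}_{(2)}(Y) → C^n_{(2)}(Y)`. -/
def l2Coboundaries : (n : ℕ) → Submodule ℂ (L2Cochains Y n)
  | 0 => ⊥
  | n + 1 => LinearMap.range (l2Coboundary π Y n).toLinearMap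

/-- The space of harmonic cochains. -/
def harmonicCochains (n : ℕ) : Submodule ℂ (L2Cochains Y n) :=
  LinearMap.ker (l2Laplacian π Y n).toLinearMap

instance (n : ℕ) : (harmonicCochains π Y n).HasOrthogonalProjection :=
  inferInstanceAs (LinearMap.ker (l2Laplacian π Y n).toLinearMap).HasOrthogonalProjection

/-- Pairing `Δ x = 0` with `x` gives `‖d* x‖² + ‖d x‖² = 0`, and `ker d*` is the orthogonal
complement of the range of `d`, closed or not. -/
theorem mem_harmonicCochains_iff (n : ℕ) (x : L2Cochains Y n) :
    x ∈ harmonicCochains π Y n ↔ l2Coboundary π Y n x = 0 ∧ x ∈ (l2Coboundaries π Y n)ᗮ := by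
  have key : ∀ {E F : Type _} [NormedAddCommGroup E] [InnerProductSpace ℂ E] [CompleteSpace E]
      [NormedAddCommGroup F] [InnerProductSpace ℂ F] [CompleteSpace F] (T : E →L[ℂ] F) (x : E),
      inner ℂ x (T.adjoint (T x)) = (‖T x‖ : ℂ) ^ 2 := by
    intro E F _ _ _ _ _ _ T x
    rw [ContinuousLinearMap.adjoint_inner_right, inner_self_eq_norm_sq_to_K]
    rfl
  cases n with
  | zero =>
    change (l2Coboundary π Y 0).adjoint (l2Coboundary π Y 0 x) = 0 ↔
      _ ∧ x ∈ (⊥ : Submodule ℂ (L2Cochains Y 0))ᗮ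
    simp only [Submodule.bot_orthogonal_eq_top, Submodule.mem_top, and_true]
    refine ⟨fun h => ?_, fun h => by rw [h, map_zero]⟩
    have h1 := key (l2Coboundary π Y 0) x
    rw [h, inner_zero_right] at h1
    simpa using h1.symm
  | succ n =>
    change l2Coboundary π Y n ((l2Coboundary π Y n).adjoint x) +
      (l2Coboundary π Y (n + 1)).adjoint (l2Coboundary π Y (n + 1) x) = 0 ↔
      _ ∧ x ∈ (LinearMap.range (l2Coboundary π Y n).toLinearMap)ᗮ
    rw [ContinuousLinearMap.orthogonal_range]
    change _ ↔ _ ∧ (l2Coboundary π Y n).adjoint x = 0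
    refine ⟨fun h => ?_, fun h => by rw [h.1, h.2, map_zero, map_zero, add_zero]⟩
    have h1 := key (l2Coboundary π Y (n + 1)) x
    have h2 := key (l2Coboundary π Y n).adjoint x
    rw [ContinuousLinearMap.adjoint_adjoint] at h2
    have h3 := congrArg (inner ℂ x) h
    rw [inner_add_right, h1, h2, inner_zero_right] at h3
    have h4 : ‖(l2Coboundary π Y n).adjoint x‖ ^ 2 + ‖l2Coboundary π Y (n + 1) x‖ ^ 2 = 0 := by
      exact_mod_cast h3
    have h5 := sq_nonneg ‖(l2Coboundary π Y n).adjoint x‖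
    have h6 := sq_nonneg ‖l2Coboundary π Y (n + 1) x‖
    constructor
    · rw [← norm_eq_zero, ← sq_eq_zero_iff]
      linarith
    · rw [← norm_eq_zero, ← sq_eq_zero_iff]
      linarith

theorem l2Coboundaries_le_ker (n : ℕ) :
    l2Coboundaries π Y n ≤ LinearMap.ker (l2Coboundary π Y n).toLinearMap := by
  cases n with
  | zero => exact bot_le
  | succ n =>
    rintro _ ⟨x, rfl⟩
    exact l2Coboundary_comp_l2Coboundary π n x

variable {Y} {K : PreAbstractSimplicialComplex V}

theorem map_extendL2_relCoboundaries_le (hK : K ≤ Y.toPreAbstractSimplicialComplex)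
    (hfin : K.faces.Finite) (n : ℕ) :
    (relCoboundaries K (boundary Y K) n).map (extendL2 Y hfin n) ≤ l2Coboundaries π Y n := by
  cases n with
  | zero =>
    change (⊥ : Submodule ℂ (Simplex K 0 → ℂ)).map _ ≤ _
    simp
  | succ n =>
    rintro _ ⟨_, ⟨f, hf, rfl⟩, rfl⟩
    exact ⟨extendL2 Y hfin n f, l2Coboundary_extendL2 π hK hfin n hf⟩

/-- A cochain of a finite subcomplex is orthogonal to all coboundaries if it is orthogonal to those
of the subcomplex. -/
theorem extendL2_mem_orthogonal (hK : K ≤ Y.toPreAbstractSimplicialComplex)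
    (hfin : K.faces.Finite) (n : ℕ) (f : Simplex K n → ℂ)
    (hf : extendL2 Y hfin n f ∈ ((relCoboundaries K ⊥ n).map (extendL2 Y hfin n))ᗮ) :
    extendL2 Y hfin n f ∈ (l2Coboundaries π Y n)ᗮ := by
  cases n with
  | zero =>
    change _ ∈ (⊥ : Submodule ℂ (L2Cochains Y 0))ᗮ
    simp
  | succ n =>
    rintro _ ⟨x, rfl⟩
    change inner ℂ (l2Coboundary π Y n x) _ = 0
    -- Only the restriction of `d x` to `K` matters, and that is the absolute coboundary of the
    -- restriction of `x`.
    rw [inner_extendL2 hK, l2Coboundary_apply, ← coboundary_restrict]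
    refine hf _ ⟨_, ⟨restrict hK n x, ?_, rfl⟩, rfl⟩
    change _ ∈ relCochains K ⊥ n
    rw [relCochains_bot]
    trivial

theorem betti_le_sum_norm_sq_harmonicProjection (hK : K ≤ Y.toPreAbstractSimplicialComplex)
    (hfin : K.faces.Finite) (n : ℕ) (A : Finset (Simplex Y.toPreAbstractSimplicialComplex n))
    (hA : ∀ t, t ∈ A ↔ t.1 ∈ K.faces) :
    (betti K n : ℝ) ≤ ∑ a ∈ A, ‖harmonicProjection π Y n (lp.single 2 a 1)‖ ^ 2
      + (boundary Y K).faces.ncard := by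
  have := finite_simplex hfin n
  set E := extendL2 Y hfin n
  have hE : Function.Injective E := extendL2_injective hK hfin n
  have hbd : (boundary Y K).faces.Finite := hfin.subset fun _ h => h.1
  -- Relative cocycles stay closed when extended by zero; orthogonality must be to the absolute
  -- coboundaries, as these are what global coboundaries restrict to. The mismatch costs at most
  -- `#∂K`.
  set W := (relCocycles K (boundary Y K) n).map E ⊓ ((relCoboundaries K ⊥ n).map E)ᗮ
  have h1 : (Module.finrank ℂ W : ℝ) ≤
      ∑ a ∈ A, ‖harmonicProjection π Y n (lp.single 2 a 1)‖ ^ 2 := by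
    refine finrank_le_sum_norm_sq_starProjection (harmonicCochains π Y n) W ?_ A ?_
    · rintro _ ⟨⟨f, hf, rfl⟩, hf'⟩
      rw [mem_harmonicCochains_iff]
      refine ⟨?_, extendL2_mem_orthogonal π hK hfin n f hf'⟩
      rw [l2Coboundary_extendL2 π hK hfin n hf.1, LinearMap.mem_ker.mp hf.2, map_zero]
    · rintro _ ⟨⟨f, -, rfl⟩, -⟩ t ht
      exact extendZero_of_notMem f fun h => ht ((hA t).mpr h)
  have h2 := finrank_le_finrank_inf_orthogonal_add
    ((relCocycles K (boundary Y K) n).map E) ((relCoboundaries K ⊥ n).map E)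
  change _ ≤ Module.finrank ℂ W + _ at h2
  rw [← (Submodule.equivMapOfInjective E hE _).finrank_eq,
    ← (Submodule.equivMapOfInjective E hE _).finrank_eq] at h2
  have h3 := finrank_relCocycles_bot_le hfin hbd n
  have h4 : betti K n + _ = _ := relBetti_add_finrank_relCoboundaries (L := ⊥) hfin n
  have h5 : betti K n ≤ Module.finrank ℂ W + (boundary Y K).faces.ncard := by omega
  have h6 : (betti K n : ℝ) ≤ Module.finrank ℂ W + (boundary Y K).faces.ncard := by
    exact_mod_cast h5
  linarith

/-- The adjoint of the coboundary maps cochains of a subcomplex to cochains of the subcomplex. -/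
theorem adjoint_l2Coboundary_extendL2_apply (hK : K ≤ Y.toPreAbstractSimplicialComplex)
    (hfin : K.faces.Finite) (n : ℕ) (g : Simplex K (n + 1) → ℂ)
    (t : Simplex Y.toPreAbstractSimplicialComplex n) (ht : t.1 ∉ K.faces) :
    (l2Coboundary π Y n).adjoint (extendL2 Y hfin (n + 1) g) t = 0 := by
  have h1 := lp.inner_single_left (𝕜 := ℂ) t (1 : ℂ)
    ((l2Coboundary π Y n).adjoint (extendL2 Y hfin (n + 1) g))
  -- The value at `t` is the pairing of `d δ_t` with the extension of `g`, and `d δ_t` vanishes on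
  -- `K` because `δ_t` does.
  have h2 : restrict hK n (lp.single (E := fun _ => ℂ) 2 t (1 : ℂ)) = 0 := by
    funext s
    rw [restrict_apply, lp.single_apply_ne _ _ _ (by rintro rfl; exact ht s.2.1)]
    rfl
  rw [ContinuousLinearMap.adjoint_inner_right, inner_extendL2 hK, l2Coboundary_apply,
    ← coboundary_restrict, h2, map_zero, map_zero, inner_zero_left] at h1
  simpa using h1.symm

/-- Write `g = d_K f`. Although `d (E f)` may be nonzero outside `K`, on `K` it equals `g`, so `⟨E
f, d* E g⟩ = ‖E g‖²`. -/
theorem eq_zero_of_adjoint_l2Coboundary_extendL2_eq_zero (hK : K ≤ Y.toPreAbstractSimplicialComplex)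
    (hfin : K.faces.Finite) (n : ℕ) (g : Simplex K (n + 1) → ℂ)
    (hg : g ∈ LinearMap.range (coboundary K n))
    (h : (l2Coboundary π Y n).adjoint (extendL2 Y hfin (n + 1) g) = 0) : g = 0 := by
  obtain ⟨f, rfl⟩ := hg
  have h1 := ContinuousLinearMap.adjoint_inner_right (l2Coboundary π Y n) (extendL2 Y hfin n f)
    (extendL2 Y hfin (n + 1) (coboundary K n f))
  rw [h, inner_zero_right, inner_extendL2 hK, l2Coboundary_apply, ← coboundary_restrict,
    restrict_extendL2] at h1
  refine extendL2_injective hK hfin (n + 1) ?_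
  rw [map_zero]
  exact inner_self_eq_zero.mp h1.symm

/-- The trace of the complementary projection over `A` is bounded below by a Hodge-type count: `W₁`
consists of coboundaries and `W₂` of images of `d*`, hence both are orthogonal to harmonic cochains
and to each other. -/
theorem sum_norm_sq_harmonicProjection_le (hK : K ≤ Y.toPreAbstractSimplicialComplex)
    (hfin : K.faces.Finite) (n : ℕ) (A : Finset (Simplex Y.toPreAbstractSimplicialComplex n))
    (hA : ∀ t, t ∈ A ↔ t.1 ∈ K.faces) :
    ∑ a ∈ A, ‖harmonicProjection π Y n (lp.single 2 a 1)‖ ^ 2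
      ≤ betti K n + (boundary Y K).faces.ncard := by
  have := finite_simplex hfin n
  have := finite_simplex hfin (n + 1)
  set E := extendL2 Y hfin n
  have hE : Function.Injective E := extendL2_injective hK hfin n
  have hbd : (boundary Y K).faces.Finite := hfin.subset fun _ h => h.1
  set R := LinearMap.range (coboundary K n)
  set φ : (Simplex K (n + 1) → ℂ) →ₗ[ℂ] L2Cochains Y n :=
    (l2Coboundary π Y n).adjoint.toLinearMap ∘ₗ extendL2 Y hfin (n + 1)
  set W₁ := (relCoboundaries K (boundary Y K) n).map E
  set W₂ := R.map φ
  have hW₁ : W₁ ≤ l2Coboundaries π Y n := map_extendL2_relCoboundaries_le π hK hfin n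
  have hker : ∀ x : L2Cochains Y n, l2Coboundary π Y n x = 0 → ∀ y ∈ W₂, inner ℂ x y = 0 := by
    rintro x hx _ ⟨g, -, rfl⟩
    change inner ℂ x ((l2Coboundary π Y n).adjoint _) = 0
    rw [ContinuousLinearMap.adjoint_inner_right, hx, inner_zero_left]
  have hortho : W₁ ⟂ W₂ := Submodule.isOrtho_iff_inner_eq.mpr fun x hx =>
    hker x (l2Coboundaries_le_ker π Y n (hW₁ hx))
  have h1 : (Module.finrank ℂ (W₁ ⊔ W₂ : Submodule ℂ _) : ℝ) ≤
      ∑ a ∈ A, ‖(harmonicCochains π Y n)ᗮ.starProjection (lp.single 2 a 1)‖ ^ 2 := by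
    refine finrank_le_sum_norm_sq_starProjection _ _ ?_ A ?_
    · refine sup_le (fun w hw x hx => ?_) fun w hw x hx => ?_
      · rw [mem_harmonicCochains_iff] at hx
        exact Submodule.inner_left_of_mem_orthogonal (hW₁ hw) hx.2
      · rw [mem_harmonicCochains_iff] at hx
        exact hker x hx.1 w hw
    · intro w hw t ht
      have ht' : t.1 ∉ K.faces := fun h => ht ((hA t).mpr h)
      obtain ⟨_, ⟨f, -, rfl⟩, _, ⟨g, -, rfl⟩, rfl⟩ := Submodule.mem_sup.mp hw
      have h2 : E f t = 0 := extendZero_of_notMem f ht'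
      have h3 : φ g t = 0 := adjoint_l2Coboundary_extendL2_apply π hK hfin n g t ht'
      rw [lp.coeFn_add, Pi.add_apply, h2, h3, add_zero]
  have h2 : ∑ a ∈ A, ‖(harmonicCochains π Y n)ᗮ.starProjection (lp.single 2 a 1)‖ ^ 2
      = A.card - ∑ a ∈ A, ‖harmonicProjection π Y n (lp.single 2 a 1)‖ ^ 2 := by
    rw [Finset.cast_card, ← Finset.sum_sub_distrib]
    refine Finset.sum_congr rfl fun a _ => ?_
    have h3 := Submodule.norm_sq_eq_add_norm_sq_starProjection (𝕜 := ℂ)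
      (lp.single (E := fun _ => ℂ) 2 a (1 : ℂ)) (harmonicCochains π Y n)
    have h4 : ‖lp.single (E := fun _ : Simplex Y.toPreAbstractSimplicialComplex n => ℂ) 2 a
        (1 : ℂ)‖ = 1 := by
      rw [lp.norm_single (by norm_num), norm_one]
    rw [h4] at h3
    change 1 ^ 2 = ‖harmonicProjection π Y n _‖ ^ 2 + _ at h3
    linarith
  have h3 : A.card = Module.finrank ℂ (Simplex K n → ℂ) := by
    have := Fintype.ofFinite (Simplex K n)
    rw [Module.finrank_fintype_fun_eq_card, ← Finset.card_univ]
    symm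
    refine Finset.card_bij (fun s _ => ⟨s.1, hK s.2.1, s.2.2⟩) (fun s _ => (hA _).mpr s.2.1) ?_ ?_
    · intro s _ t _ h
      exact Subtype.ext (Subtype.mk.inj h)
    · intro t ht
      exact ⟨⟨t.1, (hA t).mp ht, t.2.2⟩, Finset.mem_univ _, rfl⟩
  have h4 : Module.finrank ℂ R + _ = _ := LinearMap.finrank_range_add_finrank_ker (coboundary K n)
  have h5 : betti K n + _ = _ := relBetti_add_finrank_relCoboundaries (L := ⊥) hfin n
  rw [relCocycles_bot] at h5
  have h6 := finrank_relCoboundaries_bot_le hfin hbd n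
  have h7 : Module.finrank ℂ W₁ = _ := (Submodule.equivMapOfInjective E hE _).finrank_eq.symm
  have h8 : Module.finrank ℂ W₂ = Module.finrank ℂ R := by
    have h9 : Function.Injective (φ.domRestrict R) := by
      rw [← LinearMap.ker_eq_bot, LinearMap.ker_eq_bot']
      intro g hg
      exact Subtype.ext (eq_zero_of_adjoint_l2Coboundary_extendL2_eq_zero π hK hfin n g.1 g.2 hg)
    rw [← LinearMap.finrank_range_of_inj h9, LinearMap.range_domRestrict]
  rw [finrank_sup_of_isOrtho hortho, h2] at h1
  -- Here `dim W₂ = rank d_K = #A - dim Z(K)` and `dim W₁ ≥ dim B(K) - #∂K`.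
  have h10 : A.card ≤ Module.finrank ℂ W₁ + Module.finrank ℂ W₂ + betti K n
      + (boundary Y K).faces.ncard := by omega
  have h11 : (A.card : ℝ) ≤ ((Module.finrank ℂ W₁ + Module.finrank ℂ W₂ : ℕ) : ℝ) + betti K n
      + (boundary Y K).faces.ncard := by exact_mod_cast h10
  linarith

end Harmonic

/-! ### Signed permutations of square summable families -/

section SignedPermutation

variable {ι : Type*}

/-- The signed permutation `f ↦ (i ↦ ε i * f (e i))` of `ℓ²(ι)`. -/
def signedPerm (e : Equiv.Perm ι) (ε : ι → ℂ) (hε : ∀ i, ‖ε i‖ = 1) :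
    lp (fun _ : ι => ℂ) 2 →ₗᵢ[ℂ] lp (fun _ : ι => ℂ) 2 where
  toFun f := ⟨fun i => ε i * f (e i), by
    refine memℓp_gen ?_
    simp only [norm_mul, hε, one_mul]
    exact (e.summable_iff (f := fun i => ‖f i‖ ^ (2 : ENNReal).toReal)).mpr
      ((lp.memℓp f).summable (by norm_num))⟩
  map_add' f g := by
    ext i
    exact mul_add _ _ _
  map_smul' c f := by
    ext i
    exact mul_left_comm _ _ _
  norm_map' f := by
    have h : (0 : ℝ) < (2 : ENNReal).toReal := by norm_num
    refine (lp.norm_eq_tsum_rpow h _).trans (Eq.trans ?_ (lp.norm_eq_tsum_rpow h f).symm)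
    congr 1
    rw [← e.tsum_eq fun i => ‖f i‖ ^ (2 : ENNReal).toReal]
    refine tsum_congr fun i => ?_
    change ‖ε i * f (e i)‖ ^ _ = _
    rw [norm_mul, hε, one_mul]

variable (e : Equiv.Perm ι) (ε : ι → ℂ) (hε : ∀ i, ‖ε i‖ = 1)

theorem signedPerm_apply (f : lp (fun _ : ι => ℂ) 2) (i : ι) :
    signedPerm e ε hε f i = ε i * f (e i) := rfl

theorem signedPerm_surjective : Function.Surjective (signedPerm e ε hε) := by
  intro f
  refine ⟨signedPerm e.symm (fun i => (ε (e.symm i))⁻¹) (fun i => by rw [norm_inv, hε, inv_one]) f,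
    ?_⟩
  ext i
  rw [signedPerm_apply, signedPerm_apply, e.symm_apply_apply, mul_inv_cancel_left₀]
  intro h
  simpa [h] using hε i

theorem signedPerm_single [DecidableEq ι] (i : ι) :
    signedPerm e ε hε (lp.single 2 (e i) 1) = ε i • lp.single 2 i 1 := by
  ext k
  rw [signedPerm_apply, lp.coeFn_smul, Pi.smul_apply, smul_eq_mul]
  by_cases h : k = i
  · subst h
    rw [lp.single_apply_self, lp.single_apply_self]
  · rw [lp.single_apply_ne _ _ _ h, lp.single_apply_ne _ _ _ (e.injective.ne h), mul_zero,
      mul_zero]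

end SignedPermutation

/-- Since `U P x` lies in `H`, `‖P x‖² = ⟨U P x, P U x⟩`; apply Cauchy–Schwarz and cancel `‖U P x‖ =
‖P x‖`. -/
theorem norm_starProjection_le_of_isometry {E : Type*} [NormedAddCommGroup E]
    [InnerProductSpace ℂ E] (H : Submodule ℂ E) [H.HasOrthogonalProjection] (U : E →ₗᵢ[ℂ] E)
    (hU : ∀ x ∈ H, U x ∈ H) (x : E) : ‖H.starProjection x‖ ≤ ‖H.starProjection (U x)‖ := by
  have h1 : (‖H.starProjection x‖ ^ 2 : ℂ)
      = inner ℂ (U (H.starProjection x)) (H.starProjection (U x)) := by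
    rw [← Submodule.inner_starProjection_left_eq_right,
      Submodule.starProjection_eq_self_iff.mpr (hU _ (Submodule.starProjection_apply_mem _ _)),
      U.inner_map_map, ← Submodule.starProjection_eq_self_iff.mpr
        (Submodule.starProjection_apply_mem H x), Submodule.inner_starProjection_left_eq_right,
      inner_self_eq_norm_sq_to_K, Submodule.starProjection_eq_self_iff.mpr
        (Submodule.starProjection_apply_mem H x)]
    rfl
  have h2 := norm_inner_le_norm (𝕜 := ℂ) (U (H.starProjection x)) (H.starProjection (U x))
  rw [← h1, U.norm_map, norm_pow, Complex.norm_real, norm_norm, sq] at h2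
  rcases (norm_nonneg (H.starProjection x)).eq_or_lt with h | h
  · rw [← h]
    exact norm_nonneg _
  · exact le_of_mul_le_mul_left h2 h

/-! ### Equivariance of the harmonic projection -/

section Equivariance

variable {π : Type*} [Group π] {V : Type*} [LinearOrder V] [MulAction π V]

/-- The sign contributed by a pair of vertices to the orientation sign of `g`. -/
def inversionSign (g : π) (a b : V) : ℂ := if a < b ∧ g • b < g • a then -1 else 1

/-- The sign relating the orientation of the simplex `s` to the one of `g • s`. -/
def orientationSign (g : π) (s : Finset V) : ℂ := ∏ a ∈ s, ∏ b ∈ s, inversionSign g a b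

theorem norm_orientationSign (g : π) (s : Finset V) : ‖orientationSign g s‖ = 1 := by
  unfold orientationSign
  rw [norm_prod]
  refine Finset.prod_eq_one fun a _ => ?_
  rw [norm_prod]
  refine Finset.prod_eq_one fun b _ => ?_
  unfold inversionSign
  split_ifs <;> simp

theorem vertexSign_eq_prod (s : Finset V) (v : V) :
    vertexSign s v = ∏ b ∈ s, if b < v then (-1 : ℂ) else 1 := by
  rw [vertexSign, Finset.prod_ite]
  simp

/-- The order on `V` need not be preserved by `g`. Deleting `v` removes the inversions involving
`v`, and `{v, b}` is inverted exactly when the comparisons of `b` with `v` before and after `g`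
disagree. This makes the signed pullback commute with `d`. -/
theorem vertexSign_mul_orientationSign_erase (g : π) {s : Finset V} {v : V} (hv : v ∈ s) :
    vertexSign s v * orientationSign g (s.erase v)
      = orientationSign g s * vertexSign (g • s) (g • v) := by
  have h1 : vertexSign (g • s) (g • v) = ∏ b ∈ s, if g • b < g • v then (-1 : ℂ) else 1 := by
    rw [vertexSign_eq_prod, Finset.smul_finset_def,
      Finset.prod_image fun a _ b _ h => MulAction.injective g h]
  have h2 : orientationSign g s = orientationSign g (s.erase v) *
      ∏ b ∈ s.erase v, inversionSign g v b * inversionSign g b v := by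
    conv_lhs => rw [← Finset.insert_erase hv]
    have hn := Finset.notMem_erase v s
    unfold orientationSign
    simp only [Finset.prod_insert hn, Finset.prod_mul_distrib]
    have h3 : inversionSign g v v = 1 := by simp [inversionSign]
    rw [h3]
    ring
  have h4 : ∀ b ∈ s.erase v, (inversionSign g v b * inversionSign g b v) *
      (if g • b < g • v then (-1 : ℂ) else 1) = if b < v then (-1 : ℂ) else 1 := by
    intro b hb
    have hbv : b ≠ v := Finset.ne_of_mem_erase hb
    have hg : g • b ≠ g • v := fun h => hbv (MulAction.injective g h)
    unfold inversionSign
    rcases lt_or_gt_of_ne hbv with h | h <;> rcases lt_or_gt_of_ne hg with h' | h' <;>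
      simp [h, h', h.not_gt, h'.not_gt]
  rw [h1, h2, vertexSign_eq_prod, ← Finset.mul_prod_erase s _ hv,
    ← Finset.mul_prod_erase s (fun b => if g • b < g • v then (-1 : ℂ) else 1) hv,
    ← Finset.prod_congr rfl h4, Finset.prod_mul_distrib]
  simp only [lt_irrefl, if_false, one_mul]
  ring

variable (Y : AbstractSimplicialComplex V) [IsFreeCofinite π Y]

theorem smul_simplex_mem (g : π) {n : ℕ} (s : Simplex Y.toPreAbstractSimplicialComplex n) :
    g • s.1 ∈ Y.faces ∧ (g • s.1).card = n + 1 :=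
  ⟨IsFreeCofinite.smul_mem g s.1 s.2.1, by rw [Finset.card_smul_finset, s.2.2]⟩

/-- The permutation of the `n`-simplices given by a group element. -/
def simplexPerm (g : π) (n : ℕ) : Equiv.Perm (Simplex Y.toPreAbstractSimplicialComplex n) where
  toFun s := ⟨g • s.1, smul_simplex_mem Y g s⟩
  invFun s := ⟨g⁻¹ • s.1, smul_simplex_mem Y g⁻¹ s⟩
  left_inv s := Subtype.ext (inv_smul_smul g s.1)
  right_inv s := Subtype.ext (smul_inv_smul g s.1)

/-- The pull back of square summable cochains by a group element. -/
def l2Pullback (g : π) (n : ℕ) : L2Cochains Y n →ₗᵢ[ℂ] L2Cochains Y n :=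
  signedPerm (simplexPerm Y g n) (fun s => orientationSign g s.1)
    fun s => norm_orientationSign g s.1

theorem l2Pullback_apply (g : π) (n : ℕ) (x : L2Cochains Y n)
    (s : Simplex Y.toPreAbstractSimplicialComplex n) :
    l2Pullback Y g n x s = orientationSign g s.1 * x (simplexPerm Y g n s) := rfl

theorem l2Coboundary_l2Pullback (g : π) (n : ℕ) (x : L2Cochains Y n) :
    l2Coboundary π Y n (l2Pullback Y g n x) = l2Pullback Y g (n + 1) (l2Coboundary π Y n x) := by
  ext s
  rw [l2Pullback_apply, l2Coboundary_apply, l2Coboundary_apply, coboundary_apply, coboundary_apply,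
    Finset.mul_sum]
  change _ = ∑ w ∈ g • s.1, orientationSign g s.1 *
    (vertexSign (g • s.1) w * extendZero x ((g • s.1).erase w))
  rw [Finset.smul_finset_def, Finset.sum_image fun a _ b _ h => MulAction.injective g h]
  refine Finset.sum_congr rfl fun v hv => ?_
  rw [← Finset.smul_finset_def, ← mul_assoc, ← vertexSign_mul_orientationSign_erase g hv,
    extendZero_of_mem _ (s.erase_mem hv), l2Pullback_apply, mul_assoc]
  congr 2
  refine (extendZero_coe (⇑x) _).symm.trans ?_
  congr 1
  exact Finset.image_erase (MulAction.injective g) s.1 v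

theorem l2Pullback_mem_harmonicCochains (g : π) (n : ℕ) (x : L2Cochains Y n)
    (hx : x ∈ harmonicCochains π Y n) : l2Pullback Y g n x ∈ harmonicCochains π Y n := by
  rw [mem_harmonicCochains_iff] at hx ⊢
  refine ⟨by rw [l2Coboundary_l2Pullback, hx.1, map_zero], ?_⟩
  cases n with
  | zero =>
    change _ ∈ (⊥ : Submodule ℂ (L2Cochains Y 0))ᗮ
    simp
  | succ n =>
    rintro _ ⟨y, rfl⟩
    obtain ⟨z, rfl⟩ : ∃ z, l2Pullback Y g n z = y := signedPerm_surjective _ _ _ y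
    change inner ℂ (l2Coboundary π Y n (l2Pullback Y g n z)) _ = 0
    rw [l2Coboundary_l2Pullback, LinearIsometry.inner_map_map]
    exact hx.2 _ ⟨z, rfl⟩

/-- The pullback is an isometry preserving harmonic cochains and sends `δ_{gs}` to `±δ_s`; this
gives one inequality, and `g⁻¹` the other. -/
theorem norm_harmonicProjection_single_smul (g : π) (n : ℕ)
    (s : Simplex Y.toPreAbstractSimplicialComplex n) :
    ‖harmonicProjection π Y n (lp.single 2 (simplexPerm Y g n s) 1)‖
      = ‖harmonicProjection π Y n (lp.single 2 s 1)‖ := by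
  have key : ∀ (g : π) (s : Simplex Y.toPreAbstractSimplicialComplex n),
      ‖harmonicProjection π Y n (lp.single 2 (simplexPerm Y g n s) 1)‖
        ≤ ‖harmonicProjection π Y n (lp.single 2 s 1)‖ := by
    intro g s
    have h := norm_starProjection_le_of_isometry (harmonicCochains π Y n) (l2Pullback Y g n)
      (l2Pullback_mem_harmonicCochains Y g n) (lp.single 2 (simplexPerm Y g n s) 1)
    rw [l2Pullback, signedPerm_single, map_smul, norm_smul, norm_orientationSign, one_mul] at h
    exact h
  refine le_antisymm (key g s) ?_
  have h := key g⁻¹ (simplexPerm Y g n s)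
  rwa [show simplexPerm Y g⁻¹ n (simplexPerm Y g n s) = s from
    Subtype.ext (inv_smul_smul g s.1)] at h

end Equivariance

/-! ### The von Neumann trace of the harmonic projection -/

section Trace

variable (π : Type*) [Group π] {V : Type*} [LinearOrder V] [MulAction π V]
  (Y : AbstractSimplicialComplex V) [IsFreeCofinite π Y]

theorem finite_orbits (n : ℕ) : Finite (Quotient (orbitSetoid π Y n)) := by
  obtain ⟨T, hT, hcov⟩ := IsFreeCofinite.cofinite (π := π) (Y := Y)
  choose t ht g hg using fun s : Simplex Y.toPreAbstractSimplicialComplex n => hcov s.1 s.2.1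
  have := hT.to_subtype
  refine Finite.of_injective (β := T)
    (fun x : Quotient (orbitSetoid π Y n) => ⟨t x.out, ht x.out⟩) fun x y h => ?_
  have h1 : t x.out = t y.out := congrArg Subtype.val h
  rw [← x.out_eq, ← y.out_eq]
  refine Quotient.sound ?_
  change x.out.1 ∈ MulAction.orbit π y.out.1
  exact ⟨g x.out * (g y.out)⁻¹, by
    change (g x.out * (g y.out)⁻¹) • y.out.1 = x.out.1
    rw [hg y.out, mul_smul, inv_smul_smul, ← h1, ← hg x.out]⟩

theorem orbitSetoid_iff (n : ℕ) (s t : Simplex Y.toPreAbstractSimplicialComplex n) :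
    orbitSetoid π Y n s t ↔ ∃ g : π, simplexPerm Y g n t = s :=
  ⟨fun ⟨g, hg⟩ => ⟨g, Subtype.ext hg⟩, fun ⟨g, hg⟩ => ⟨g, congrArg Subtype.val hg⟩⟩

theorem l2Betti_eq_finsum (n : ℕ) :
    l2Betti π Y n = ∑ᶠ x : Quotient (orbitSetoid π Y n),
      ‖harmonicProjection π Y n (lp.single 2 x.out 1)‖ ^ 2 := by
  have := finite_orbits π Y n
  have := Fintype.ofFinite (Quotient (orbitSetoid π Y n))
  rw [l2Betti, vonNeumannTrace, finsum_eq_sum_of_fintype, finsum_eq_sum_of_fintype, Complex.re_sum]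
  refine Finset.sum_congr rfl fun x _ => ?_
  change (inner ℂ _ ((harmonicCochains π Y n).starProjection _)).re
    = ‖(harmonicCochains π Y n).starProjection _‖ ^ 2
  rw [← Submodule.starProjection_eq_self_iff.mpr (Submodule.starProjection_apply_mem
    (harmonicCochains π Y n) (lp.single 2 x.out 1)),
    ← Submodule.inner_starProjection_left_eq_right, inner_self_eq_norm_sq_to_K,
    Submodule.starProjection_eq_self_iff.mpr (Submodule.starProjection_apply_mem
    (harmonicCochains π Y n) (lp.single 2 x.out 1))]
  norm_cast

end Trace

/-! ### Counting simplices in a union of translates -/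

section Counting

/-- Local finiteness provides a maximal coface. A maximal simplex is interior to every subcomplex
containing it, which is how disjointness of interiors becomes usable. -/
theorem exists_maximal_coface (π : Type*) [Group π] {V : Type*} [LinearOrder V] [MulAction π V]
    {Y : AbstractSimplicialComplex V} [IsFreeCofinite π Y] {s : Finset V} (hs : s ∈ Y.faces) :
    ∃ t ∈ Y.faces, s ⊆ t ∧ ∀ r ∈ Y.faces, t ⊆ r → r = t := by
  obtain ⟨B, hB⟩ := exists_card_cofaces_le π Y
  have hfin : {t | t ∈ Y.faces ∧ s ⊆ t}.Finite := by
    by_contra h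
    obtain ⟨A, hA, hcard⟩ := Set.Infinite.exists_subset_card_eq h (B + 1)
    have := hB s hs A fun t ht => hA ht
    omega
  obtain ⟨t, hst, ht⟩ := hfin.exists_le_maximal (a := s) ⟨hs, subset_rfl⟩
  exact ⟨t, ht.prop.1, hst, fun r hr htr =>
    (ht.eq_of_le (y := r) ⟨hr, hst.trans htr⟩ htr).symm⟩

variable {π : Type*} [Group π] {V : Type*} [LinearOrder V] [MulAction π V]
  {Y : AbstractSimplicialComplex V} {F : PreAbstractSimplicialComplex V}

theorem mem_translate {g : π} {s : Finset V} :
    s ∈ (translate g F).faces ↔ ∃ r ∈ F.faces, g • r = s := Iff.rfl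

/-- The group elements whose translate of `F` meets the boundary of `K`. -/
def meetsBoundary (Y : AbstractSimplicialComplex V) (F K : PreAbstractSimplicialComplex V) :
    Set π :=
  {g | ((translate g F).faces ∩ (boundary Y K).faces).Nonempty}

theorem wordDist_self (S : Finset π) (g : π) : wordDist S g g = 0 :=
  Nat.sInf_eq_zero.mpr (Or.inl ⟨[], rfl, by simp, by simp⟩)

theorem eq_of_wordDist_eq_zero {S : Finset π} (hS : Subgroup.closure (S : Set π) = ⊤) {g h : π}
    (hgh : wordDist S g h = 0) : g = h := by
  rcases Nat.sInf_eq_zero.mp hgh with ⟨l, hl, -, hprod⟩ | hempty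
  · rw [List.length_eq_zero_iff.mp hl, List.prod_nil] at hprod
    exact (inv_mul_eq_one.mp hprod.symm)
  -- `sInf ∅ = 0` would also give distance zero; generation by `S` excludes the empty case.
  · have hmem : g⁻¹ * h ∈ (Subgroup.closure (S : Set π)).toSubmonoid := by
      rw [hS]
      trivial
    rw [Subgroup.closure_toSubmonoid] at hmem
    obtain ⟨l, hl, hprod⟩ := Submonoid.exists_list_of_mem_closure hmem
    exact absurd hempty (Set.Nonempty.ne_empty ⟨l.length, l, rfl, hl, hprod⟩)

theorem nearBoundary_one_half {S : Finset π} (hS : Subgroup.closure (S : Set π) = ⊤)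
    (F K : PreAbstractSimplicialComplex V) :
    nearBoundary S Y F K (1 / 2) = meetsBoundary Y F K := by
  ext g
  constructor
  · rintro ⟨h, hne, hd⟩
    have h0 : wordDist S g h = 0 := by
      by_contra h0
      have h1 : (1 : ℝ) ≤ wordDist S g h := by exact_mod_cast Nat.one_le_iff_ne_zero.mpr h0
      linarith
    rwa [eq_of_wordDist_eq_zero hS h0]
  · intro hg
    exact ⟨g, hg, by rw [wordDist_self]; norm_num⟩

theorem finite_translate (hF : IsFundamentalDomain π Y F) (g : π) :
    (translate g F).faces.Finite :=
  hF.finite.image _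

variable {Λ : Finset π} {K : PreAbstractSimplicialComplex V}

theorem mem_faces_iff (hK : K = ⨆ g ∈ Λ, translate g F) {s : Finset V} :
    s ∈ K.faces ↔ ∃ g ∈ Λ, s ∈ (translate g F).faces := by
  constructor
  · intro hs
    let U : PreAbstractSimplicialComplex V :=
      { faces := ⋃ g ∈ Λ, (translate g F).faces
        isRelLowerSet_faces :=
          IsRelLowerSet.iUnion₂ fun g _ => (translate g F).isRelLowerSet_faces }
    have h1 : K ≤ U := by
      rw [hK]
      exact iSup₂_le fun g hg => Set.subset_biUnion_of_mem (u := fun g => (translate g F).faces) hg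
    simpa using Set.mem_iUnion₂.mp (h1 hs)
  · rintro ⟨g, hg, hs⟩
    rw [hK]
    exact le_iSup₂ (f := fun g (_ : g ∈ Λ) => translate g F) g hg hs

theorem finite_of_eq_iSup_translate (hF : IsFundamentalDomain π Y F)
    (hK : K = ⨆ g ∈ Λ, translate g F) : K.faces.Finite := by
  refine (Λ.finite_toSet.biUnion fun g _ => finite_translate hF g).subset fun s hs => ?_
  simpa using (mem_faces_iff hK).mp hs

variable [IsFreeCofinite π Y]

theorem eq_of_smul_eq_smul {s : Finset V} (hs : s ∈ Y.faces) {g h : π} (hgh : g • s = h • s) :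
    g = h := by
  have h1 : (h⁻¹ * g) • s = s := by rw [mul_smul, hgh, inv_smul_smul]
  exact (inv_mul_eq_one.mp (IsFreeCofinite.free (h⁻¹ * g) s hs h1)).symm

theorem translate_le (hF : IsFundamentalDomain π Y F) (g : π) :
    translate g F ≤ Y.toPreAbstractSimplicialComplex := by
  rintro _ ⟨r, hr, rfl⟩
  exact IsFreeCofinite.smul_mem g r (hF.le hr)

/-- By freeness, `g` is determined by a simplex `q` of `F` and its image `g • q` in `K`. -/
theorem finite_meetsBoundary (hF : IsFundamentalDomain π Y F)
    (hK : K.faces.Finite) : (meetsBoundary Y F K : Set π).Finite := by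
  choose r hr using fun g : (meetsBoundary Y F K : Set π) => g.2
  choose q hq hqr using fun g => mem_translate.mp (hr g).1
  refine Set.finite_coe_iff.mp ?_
  have := hK.to_subtype
  have := hF.finite.to_subtype
  refine Finite.of_injective (β := F.faces × K.faces)
    (fun g => (⟨q g, hq g⟩, ⟨r g, (hr g).2.1⟩)) fun g h hgh => ?_
  have h1 : q g = q h := congrArg (fun p => p.1.1) hgh
  have h2 : r g = r h := congrArg (fun p => p.2.1) hgh
  exact Subtype.ext (eq_of_smul_eq_smul (hF.le (hq g)) (by rw [hqr g, h1, hqr h, h2]))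

/-- Each boundary simplex lies in some translate, which then meets the boundary by definition. -/
theorem ncard_boundary_le (hF : IsFundamentalDomain π Y F)
    (hK : K.faces.Finite) (hKY : K ≤ Y.toPreAbstractSimplicialComplex) :
    (boundary Y K).faces.ncard ≤ (meetsBoundary Y F K : Set π).ncard * F.faces.ncard := by
  rw [← Set.ncard_prod]
  refine (Set.ncard_le_ncard (t := (fun p : π × Finset V => p.1 • p.2) ''
    ((meetsBoundary Y F K : Set π) ×ˢ F.faces)) (fun s hs => ?_)
    (((finite_meetsBoundary hF hK).prod hF.finite).image _)).trans
    (Set.ncard_image_le ((finite_meetsBoundary hF hK).prod hF.finite))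
  obtain ⟨g, hg⟩ := hF.covers s (hKY hs.1)
  obtain ⟨r, hr, hrs⟩ := mem_translate.mp hg
  exact ⟨(g, r), ⟨⟨s, hg, hs⟩, hr⟩, hrs⟩

theorem le_of_eq_iSup_translate (hF : IsFundamentalDomain π Y F)
    (hK : K = ⨆ g ∈ Λ, translate g F) : K ≤ Y.toPreAbstractSimplicialComplex := by
  rw [hK]
  exact iSup₂_le fun g _ => translate_le hF g

/-- If `s` lies in a maximal simplex contained in `F`, then the translates of `s` contained in a
union `K` of translates of `F` are, up to the boundary, those by the elements defining `K`. -/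
theorem smul_mem_faces_imp (hF : IsFundamentalDomain π Y F) (hK : K = ⨆ g ∈ Λ, translate g F)
    {s t : Finset V} (hst : s ⊆ t) (hs : s ∈ F.faces) (ht : t ∈ F.faces)
    (hmax : ∀ r ∈ Y.faces, t ⊆ r → r = t) {g : π} (hg : g • s ∈ K.faces) :
    g ∈ Λ ∨ g ∈ (meetsBoundary Y F K : Set π) := by
  by_cases hb : g • s ∈ (boundary Y K).faces
  · exact Or.inr ⟨g • s, mem_translate.mpr ⟨s, hs, rfl⟩, hb⟩
  left
  have hint : g • s ∈ interiorFaces Y K := by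
    by_contra h
    exact hb ⟨hg, h⟩
  have h1 : g • t ∈ K.faces := hint.2 _ (IsFreeCofinite.smul_mem g t (hF.le ht))
    (Finset.smul_finset_subset_smul_finset hst)
  obtain ⟨h, hh, hth⟩ := (mem_faces_iff hK).mp h1
  have hmax' : ∀ r ∈ Y.faces, g • t ⊆ r → r = g • t := by
    intro r hr htr
    rw [← hmax (g⁻¹ • r) (IsFreeCofinite.smul_mem g⁻¹ r hr)
      (Finset.subset_smul_finset_iff.mpr (by rwa [inv_inv])), smul_inv_smul]
  -- The maximal simplex `g • t` is interior to both `g • F` and `h • F`, which forces `g = h ∈ Λ`.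
  have hmem : ∀ k : π, g • t ∈ (translate k F).faces → g • t ∈ interiorFaces Y (translate k F) :=
    fun k hk => ⟨hk, fun r hr htr => by rwa [hmax' r hr htr]⟩
  by_contra hgΛ
  have hne : g ≠ h := fun h' => hgΛ (h' ▸ hh)
  exact Set.disjoint_left.mp (hF.disjoint g h hne)
    (hmem g (mem_translate.mpr ⟨t, ht, rfl⟩)) (hmem h hth)

theorem exists_good_representative (hF : IsFundamentalDomain π Y F) {s : Finset V}
    (hs : s ∈ Y.faces) : ∃ g : π, g • s ∈ F.faces ∧ ∃ t ∈ F.faces, g • s ⊆ t ∧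
      ∀ r ∈ Y.faces, t ⊆ r → r = t := by
  obtain ⟨t, ht, hst, hmax⟩ := exists_maximal_coface π hs
  obtain ⟨g, hg⟩ := hF.covers t ht
  obtain ⟨r, hr, rfl⟩ := mem_translate.mp hg
  have h1 : g⁻¹ • s ⊆ r := Finset.smul_finset_subset_iff.mpr (by rwa [inv_inv])
  refine ⟨g⁻¹, (F.isRelLowerSet_faces hr).2 h1 ?_, r, hr, h1, fun q hq hrq => ?_⟩
  · exact (Y.isRelLowerSet_faces hs).1.smul_finset
  · rw [← inv_smul_smul g q, hmax (g • q) (IsFreeCofinite.smul_mem g q hq)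
      (Finset.smul_finset_subset_smul_finset hrq), inv_smul_smul]

-- With `σ` a representative in `F` having a maximal coface in `F`, `g ↦ g • σ` is injective by
-- freeness. It sends `Λ` into `K`, and any further `g` landing in `K` meets the boundary.
open Classical in
theorem abs_card_orbit_sub_le (hF : IsFundamentalDomain π Y F) (hK : K = ⨆ g ∈ Λ, translate g F)
    {n : ℕ} (A : Finset (Simplex Y.toPreAbstractSimplicialComplex n))
    (hA : ∀ t, t ∈ A ↔ t.1 ∈ K.faces) (x : Quotient (orbitSetoid π Y n)) :
    |((A.filter fun t => Quotient.mk _ t = x).card : ℝ) - Λ.card|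
      ≤ (meetsBoundary Y F K : Set π).ncard := by
  obtain ⟨s, rfl⟩ := Quotient.exists_rep x
  obtain ⟨g₀, hs, t, ht, hst, hmax⟩ := exists_good_representative (π := π) hF s.2.1
  set σ := simplexPerm Y g₀ n s
  have hfin := finite_meetsBoundary hF (finite_of_eq_iSup_translate hF hK)
  have h1 : Λ.card
      ≤ (A.filter fun t => Quotient.mk (orbitSetoid π Y n) t = Quotient.mk _ s).card := by
    refine Finset.card_le_card_of_injOn (fun g => simplexPerm Y g n σ) (fun g hg => ?_)
      fun g _ h _ hgh => eq_of_smul_eq_smul σ.2.1 (congrArg Subtype.val hgh)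
    rw [Finset.mem_coe, Finset.mem_filter, hA]
    refine ⟨(mem_faces_iff hK).mpr ⟨g, hg, mem_translate.mpr ⟨_, hs, rfl⟩⟩, Quotient.sound ?_⟩
    exact (orbitSetoid_iff π Y n _ _).mpr ⟨g * g₀, Subtype.ext (mul_smul g g₀ s.1)⟩
  have h2 : (A.filter fun t => Quotient.mk (orbitSetoid π Y n) t = Quotient.mk _ s).card
      ≤ Λ.card + (meetsBoundary Y F K : Set π).ncard := by
    rw [Set.ncard_eq_toFinset_card _ hfin]
    refine le_trans (Finset.card_le_card (t := (Λ ∪ hfin.toFinset).image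
      fun g => simplexPerm Y g n σ) fun t ht => ?_) (Finset.card_image_le.trans
        (Finset.card_union_le _ _))
    rw [Finset.mem_filter, hA] at ht
    obtain ⟨g, hg⟩ := (orbitSetoid_iff π Y n _ _).mp (Quotient.exact ht.2)
    have hgt : simplexPerm Y (g * g₀⁻¹) n σ = t := by
      rw [← hg]
      refine Subtype.ext ?_
      change (g * g₀⁻¹) • g₀ • s.1 = g • s.1
      rw [mul_smul, inv_smul_smul]
    refine Finset.mem_image.mpr ⟨g * g₀⁻¹, ?_, hgt⟩
    rw [Finset.mem_union, Set.Finite.mem_toFinset]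
    refine smul_mem_faces_imp hF hK hst hs ‹_› hmax ?_
    rw [← hgt] at ht
    exact ht.1
  have h1' : (Λ.card : ℝ) ≤ _ := Nat.cast_le.mpr h1
  have h2' := (Nat.cast_le (α := ℝ)).mpr h2
  rw [Nat.cast_add] at h2'
  rw [abs_le]
  constructor
  · have : (0 : ℝ) ≤ (meetsBoundary Y F K : Set π).ncard := Nat.cast_nonneg _
    linarith
  · linarith

theorem abs_sum_sub_le (hF : IsFundamentalDomain π Y F) (hK : K = ⨆ g ∈ Λ, translate g F)
    {n : ℕ} (A : Finset (Simplex Y.toPreAbstractSimplicialComplex n))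
    (hA : ∀ t, t ∈ A ↔ t.1 ∈ K.faces) :
    |∑ a ∈ A, ‖harmonicProjection π Y n (lp.single 2 a 1)‖ ^ 2 - Λ.card * l2Betti π Y n|
      ≤ (meetsBoundary Y F K : Set π).ncard * l2Betti π Y n := by
  classical
  have := finite_orbits π Y n
  have := Fintype.ofFinite (Quotient (orbitSetoid π Y n))
  rw [l2Betti_eq_finsum, finsum_eq_sum_of_fintype,
    ← Finset.sum_fiberwise A (fun t => (Quotient.mk _ t : Quotient (orbitSetoid π Y n))),
    Finset.mul_sum, Finset.mul_sum, ← Finset.sum_sub_distrib]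
  refine (Finset.abs_sum_le_sum_abs _ _).trans (Finset.sum_le_sum fun x _ => ?_)
  have h1 : ∑ a ∈ A with Quotient.mk (orbitSetoid π Y n) a = x,
      ‖harmonicProjection π Y n (lp.single 2 a 1)‖ ^ 2
      = (A.filter fun t => Quotient.mk (orbitSetoid π Y n) t = x).card *
        ‖harmonicProjection π Y n (lp.single 2 x.out 1)‖ ^ 2 := by
    rw [← nsmul_eq_mul]
    refine Finset.sum_eq_card_nsmul fun t ht => ?_
    obtain ⟨g, hg⟩ := (orbitSetoid_iff π Y n _ _).mp
      (Quotient.exact ((Finset.mem_filter.mp ht).2.trans x.out_eq.symm))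
    rw [← hg, norm_harmonicProjection_single_smul]
  rw [h1, ← sub_mul, abs_mul, abs_of_nonneg (sq_nonneg ‖_‖)]
  exact mul_le_mul_of_nonneg_right (abs_card_orbit_sub_le hF hK A hA x) (sq_nonneg _)

theorem abs_betti_sub_le (hF : IsFundamentalDomain π Y F) (hK : K = ⨆ g ∈ Λ, translate g F)
    (n : ℕ) : |(betti K n : ℝ) - Λ.card * l2Betti π Y n|
      ≤ (meetsBoundary Y F K : Set π).ncard * (l2Betti π Y n + F.faces.ncard) := by
  have hKY := le_of_eq_iSup_translate hF hK
  have hfin := finite_of_eq_iSup_translate hF hK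
  have hAfin : {t : Simplex Y.toPreAbstractSimplicialComplex n | t.1 ∈ K.faces}.Finite :=
    hfin.preimage Subtype.val_injective.injOn
  have hA : ∀ t, t ∈ hAfin.toFinset ↔ t.1 ∈ K.faces := fun t => hAfin.mem_toFinset
  have h1 := abs_le.mp (abs_sum_sub_le hF hK _ hA)
  have h2 := betti_le_sum_norm_sq_harmonicProjection π hKY hfin n _ hA
  have h3 := sum_norm_sq_harmonicProjection_le π hKY hfin n _ hA
  have h4 : ((boundary Y K).faces.ncard : ℝ)
      ≤ (meetsBoundary Y F K : Set π).ncard * F.faces.ncard := by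
    exact_mod_cast ncard_boundary_le hF hfin hKY
  rw [abs_le, mul_add]
  constructor <;> linarith

/-- The boundary is paid for twice: once for the absolute Betti number, once for passing to the
relative one. -/
theorem abs_relBetti_boundary_sub_le (hF : IsFundamentalDomain π Y F)
    (hK : K = ⨆ g ∈ Λ, translate g F) (n : ℕ) :
    |(relBetti K (boundary Y K) n : ℝ) - Λ.card * l2Betti π Y n|
      ≤ (meetsBoundary Y F K : Set π).ncard * (l2Betti π Y n + 2 * F.faces.ncard) := by
  have hfin := finite_of_eq_iSup_translate hF hK
  have h1 := abs_le.mp (abs_betti_sub_le hF hK n)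
  have h2 := abs_le.mp (abs_relBetti_sub_betti_le (L := boundary Y K) hfin
    (hfin.subset fun _ h => h.1) n)
  have h4 : ((boundary Y K).faces.ncard : ℝ)
      ≤ (meetsBoundary Y F K : Set π).ncard * F.faces.ncard := by
    exact_mod_cast ncard_boundary_le hF hfin (le_of_eq_iSup_translate hF hK)
  rw [abs_le]
  constructor <;> linarith

end Counting

theorem tendsto_div_of_abs_sub_mul_le {a N c : ℕ → ℝ} {b C : ℝ} (hN : ∀ m, 0 < N m)
    (h : ∀ m, |a m - N m * b| ≤ c m * C) (hc : Tendsto (fun m => c m / N m) atTop (𝓝 0)) :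
    Tendsto (fun m => a m / N m) atTop (𝓝 b) := by
  rw [tendsto_iff_norm_sub_tendsto_zero]
  have h0 := hc.mul_const C
  rw [zero_mul] at h0
  refine squeeze_zero (fun m => norm_nonneg _) (fun m => ?_) h0
  have h1 : a m / N m - b = (a m - N m * b) / N m := by
    rw [sub_div, mul_div_cancel_left₀ _ (hN m).ne']
  rw [h1, Real.norm_eq_abs, abs_div, abs_of_pos (hN m), div_mul_eq_mul_div]
  exact div_le_div_of_nonneg_right (h m) (hN m).le

end AmenableL2

end

theorem theorem0p1 {π V : Type*} [Group π] [LinearOrder V] [MulAction π V]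
    (Y : AbstractSimplicialComplex V) (hconn : (oneSkeleton Y).Connected)
    [IsFreeCofinite π Y]
    (S : Finset π) (hS : Subgroup.closure (S : Set π) = ⊤) (hamen : IsAmenable S)
    (F : PreAbstractSimplicialComplex V) (hF : IsFundamentalDomain π Y F)
    (Λ : ℕ → Finset π) (Ym : ℕ → PreAbstractSimplicialComplex V)
    (hYm : IsRegularExhaustion S Y F Λ Ym) (j : ℕ) :
    Tendsto (fun m => (betti (Ym m) j : ℝ) / (Λ m).card) atTop (𝓝 (l2Betti π Y j)) ∧
    Tendsto (fun m => (relBetti (Ym m) (boundary Y (Ym m)) j : ℝ) / (Λ m).card) atTop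
      (𝓝 (l2Betti π Y j)) := by
  have hN : ∀ m, (0 : ℝ) < (Λ m).card := fun m =>
    Nat.cast_pos.mpr (Finset.card_pos.mpr (hYm.nonempty m))
  -- Word distances are integers, so radius `1 / 2` counts exactly the translates that meet the
  -- boundary.
  have hc := hYm.tendsto_zero (1 / 2) (by norm_num)
  simp only [nearBoundary_one_half hS] at hc
  exact ⟨tendsto_div_of_abs_sub_mul_le hN (fun m => abs_betti_sub_le hF (hYm.eq_iSup m) j) hc,
    tendsto_div_of_abs_sub_mul_le hN
      (fun m => abs_relBetti_boundary_sub_le hF (hYm.eq_iSup m) j) hc⟩
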